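/- There is a universal constant $c>0$ with the following property. Let $1\le p\le n$ be integers, $\beta>0$, and let $M=[t_{ij}]_{1\le i\le p,\,1\le j\le n}$ be a random $p\times n$ matrix whose entries are independent (not necessarily identically distributed) complex random variables with $$\mathbf E(t_{ij})=0,\qquad \mathbf E(|t_{ij}|^2)=1,\qquad \mathbf E(|t_{ij}|^4)\le\beta\quad\text{for all } i,j.$$ Put $W:=M^*M$, $\phi:=p/n\in(0,1]$, $a:=(1-\sqrt\phi)^2$, $b:=(1+\sqrt\phi)^2$, and let $$\mu_\phi:=(1-\phi)\,\delta_0+\frac{1}{2\pi t}\sqrt{\big((t-a)(b-t)\big)_+}\;dt,\qquad x_+:=\max(x,0),$$ be the Marchenko–Pastur law, with logarithmic potential $u_\phi(z):=\int\log|z-t|\,d\mu_\phi(t)$. Then for every $z\in[a,b]$ the random variable $|\det(z-n^{-1}W)|^2$ is integrable and $$\mathbf E\big(|\det(z-n^{-1}W)|^2\big)\le c\,p^{13/2}\,n^{1/2}\,e^{\beta}\,e^{2n\,u_\phi(z)}.$$ -/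

import Mathlib

open MeasureTheory ProbabilityTheory
open scoped Matrix

noncomputable section

namespace MarchenkoPastur

/-- Left endpoint `a = (1 - √φ)²` of the bulk. -/
def lower (φ : ℝ) : ℝ := (1 - √φ) ^ 2

/-- Right endpoint `b = (1 + √φ)²` of the bulk. -/
def upper (φ : ℝ) : ℝ := (1 + √φ) ^ 2

/-- Density `(2πt)⁻¹ √(((t - a)(b - t))₊)` of the absolutely continuous part. -/
def density (φ t : ℝ) : ℝ :=
  1 / (2 * Real.pi * t) * √(max ((t - lower φ) * (upper φ - t)) 0)

/-- The Marchenko–Pastur law `μ_φ = (1 - φ) δ₀ + (2πt)⁻¹ √(((t - a)(b - t))₊) dt`,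
for `φ ∈ (0, 1]`. -/
def law (φ : ℝ) : Measure ℝ :=
  ENNReal.ofReal (1 - φ) • Measure.dirac 0 +
    volume.withDensity (fun t => ENNReal.ofReal (density φ t))

/-- Logarithmic potential `u(z) = ∫ log |z - t| dμ(t)` of a measure on the real line. -/
def logPotential (μ : Measure ℝ) (z : ℂ) : ℝ :=
  ∫ t, Real.log ‖z - (t : ℂ)‖ ∂μ

/-- The covariance matrix `W = M* M`. -/
def covMatrix {p n : ℕ} (M : Matrix (Fin p) (Fin n) ℂ) : Matrix (Fin n) (Fin n) ℂ :=
  Mᴴ * M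

end MarchenkoPastur

end

/-! Up to the factor `n⁻ⁿ (nz)^(n-p)`, the determinant is `det (x - M M*)` of size `p` at `x = nz`.
Write each row's rank-one matrix as identity plus a centred part. Multilinearity then gives an
expansion over sets `S` of rows, in which a Laguerre polynomial of degree `p - |S|` multiplies a
mixed minor of the centred parts of the rows in `S` (`det_sub_gram_expansion`). Rows are independent
and the centred parts have mean zero, so distinct `S` are orthogonal in `L²`: the second moment is a
single sum over `S` of squares.

Two estimates control a summand with `|S| = m`. Pairing indices bounds the second moment of the
mixed minor by `(n)ₘ (m+1)! e^(β-1)`: in each row the four indices either pair up in one of two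
ways, at cost at most 1, or all coincide, at extra cost `β - 1` (`sum_prod_covBound_le`). Cauchy's
estimate for `e^(xt) (1-t)ⁿ` bounds the Laguerre factor: `|L|² x^(n-p)` is at most `3 √p (p-m)!
(n-m)! eˣ` (`norm_laguerre_sq_mul_pow_le`). With the `C(p,m)` choices of `S` the factorials collapse
to `(m+1) p! n!`, so summing over `m` costs only a power of `p`.

The potential is explicit on the bulk: `2u = z + (1-φ) log z + φ log φ - 1 - φ`
(`logPotential_law`). It comes from the substitution `t = 1 + φ + 2√φ cos θ` and Poisson's formula
on the unit circle. Stirling's upper bound for `p! n!` then reproduces `e^(2nu)` up to a constant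
times `p³ √n`. -/

namespace MarchenkoPastur

/-! ### Expansion of the characteristic polynomial over sets of centred rows. -/

section Expansion

variable {ι κ : Type*} [Fintype ι] [DecidableEq ι] [Fintype κ] [DecidableEq κ]

/-- A function of the restriction to `S` of an embedding, summed over all embeddings. -/
lemma sum_embedding_restrict (S : Finset ι) (G : (S → κ) → ℂ) :
    ∑ σ : ι ↪ κ, G (fun a => σ a) =
      ((Fintype.card κ - S.card).descFactorial (Fintype.card ι - S.card) : ℂ) *
        ∑ τ : S ↪ κ, G τ := by
  classical
  let e : (ι ↪ κ) ≃ (Σ f : S ↪ κ, {a // ¬ a ∈ S} ↪ ↥(Set.range f)ᶜ) :=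
    (Equiv.embeddingCongr (Equiv.sumCompl (fun a => a ∈ S)).symm (Equiv.refl κ)).trans
      Equiv.sumEmbeddingEquivSigmaEmbeddingRestricted
  have he : ∀ σ : ι ↪ κ, ∀ a : S, (e σ).1 a = σ a := fun σ a => rfl
  rw [Finset.mul_sum]
  have h1 : ∑ σ : ι ↪ κ, G (fun a => σ a) = ∑ σ : ι ↪ κ, (fun y => G y.1) (e σ) := by
    refine Finset.sum_congr rfl fun σ _ => ?_
    congr 1
  rw [h1, Equiv.sum_comp e (fun y => G y.1), Fintype.sum_sigma]
  refine Finset.sum_congr rfl fun f _ => ?_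
  simp only [Finset.sum_const, Finset.card_univ, nsmul_eq_mul]
  congr 2
  rw [Fintype.card_embedding_eq]
  congr 1
  · rw [Fintype.card_compl_set, Set.card_range_of_injective f.injective, Fintype.card_coe]
  · rw [Fintype.card_subtype_compl, Fintype.card_coe]

/-- Mixed minors of a family of matrices: `∑ det (A a (σ a) (σ b))` over embeddings `σ` of `S`. -/
noncomputable def mixedMinor (A : ι → κ → κ → ℂ) (S : Finset ι) : ℂ :=
  ∑ σ : S ↪ κ, (Matrix.of fun a b : S => A a (σ a) (σ b)).det

/-- Each row of the Gram matrix is a sum over columns, so multilinearity gives one determinant per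
function `σ`. Pulling out the row scalars and transposing the rest makes row `a` of the determinant
depend on row `a` of `N` alone, the form that independence can use. A non-injective `σ` repeats a
column. -/
lemma det_gram (N : Matrix ι κ ℂ) :
    (N * Nᴴ).det =
      ∑ σ : ι ↪ κ, (Matrix.of fun a b => N a (σ a) * star (N a (σ b))).det := by
  classical
  have h1 : (N * Nᴴ).det =
      ∑ σ : ι → κ, (Matrix.of fun a b => N a (σ a) * star (N b (σ a))).det := by
    have := (Matrix.detRowAlternating (n := ι) (R := ℂ)).toMultilinearMap.map_sum
      (fun a j b => N a j * star (N b j))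
    have h2 : (fun i => ∑ j : κ, fun b => N i j * star (N b j)) = N * Nᴴ := by
      ext a b
      simp [Matrix.mul_apply, Matrix.conjTranspose_apply]
    rw [h2] at this
    exact this
  have h3 : ∀ σ : ι → κ, (Matrix.of fun a b => N a (σ a) * star (N b (σ a))).det =
      (Matrix.of fun a b => N a (σ a) * star (N a (σ b))).det := by
    intro σ
    have e1 := Matrix.det_mul_column (fun a => N a (σ a)) (Matrix.of fun a b => star (N b (σ a)))
    have e2 := Matrix.det_mul_column (fun a => N a (σ a)) (Matrix.of fun a b => star (N a (σ b)))
    have e3 : (Matrix.of fun a b => star (N a (σ b))).det =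
        (Matrix.of fun a b => star (N b (σ a))).det := by
      rw [← Matrix.det_transpose]; rfl
    simp only [Matrix.of_apply] at e1 e2
    rw [e1, e2, e3]
  rw [h1]
  simp_rw [h3]
  have h4 : ∀ σ : ι → κ, ¬ Function.Injective σ →
      (Matrix.of fun a b => N a (σ a) * star (N a (σ b))).det = 0 := by
    intro σ hσ
    simp only [Function.Injective, not_forall] at hσ
    obtain ⟨a, b, hab, hne⟩ := hσ
    refine Matrix.det_zero_of_column_eq hne fun k => ?_
    simp [hab]
  rw [← Finset.sum_subset (Finset.subset_univ
    (Finset.univ.filter fun σ : ι → κ => Function.Injective σ))]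
  · rw [Finset.sum_subtype (p := fun σ : ι → κ => Function.Injective σ) _ (by simp)]
    exact Equiv.sum_comp (Equiv.subtypeInjectiveEquivEmbedding ι κ)
      (fun σ : ι ↪ κ => (Matrix.of fun a b => N a (σ a) * star (N a (σ b))).det)
  · intro σ _ h
    exact h4 σ (by simpa using h)

lemma det_scalar_sub (B : Matrix ι ι ℂ) (x : ℂ) :
    (Matrix.scalar ι x - B).det =
      ∑ R : Finset ι, (-1) ^ R.card * x ^ (Fintype.card ι - R.card) *
        (B.submatrix (Subtype.val : R → ι) Subtype.val).det := by
  rw [← Matrix.eval_charpoly, Polynomial.eval_eq_sum_range, Matrix.charpoly_natDegree_eq_dim,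
    ← Finset.sum_range_reflect]
  rw [← Finset.powerset_univ, Finset.sum_powerset]
  rw [Finset.card_univ]
  refine Finset.sum_congr rfl fun k hk => ?_
  have hk' : k ≤ Fintype.card ι := by simpa [Nat.lt_succ_iff] using hk
  have e : Fintype.card ι + 1 - 1 - k = Fintype.card ι - k := by omega
  rw [e, Matrix.charpoly_coeff_eq_sum_minors _ _ hk', Finset.mul_sum, Finset.sum_mul]
  refine Finset.sum_congr rfl fun R hR => ?_
  rw [(Finset.mem_powersetCard.mp hR).2]
  ring

/-- The expected characteristic polynomial `∑ (-1)ᵏ C(p,k) (n)ₖ x^(p-k)`, a Laguerre polynomial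
up to normalisation. -/
noncomputable def laguerre (p n : ℕ) (x : ℂ) : ℂ :=
  ∑ k ∈ Finset.range (p + 1), (-1) ^ k * (p.choose k) * (n.descFactorial k) * x ^ (p - k)

/-- Entries of the centred rank-one matrix of a vector. -/
noncomputable def centred (j k : κ) (v : κ → ℂ) : ℂ :=
  v j * star (v k) - if j = k then 1 else 0

/-- The centred rank-one matrices attached to the rows of `N`. -/
noncomputable def centredRow (N : ι → κ → ℂ) (a : ι) (j k : κ) : ℂ :=
  centred j k (N a)

/-- A principal minor is a full determinant with identity rows outside the index set; multilinearity
chooses between `X` and the identity in each row of `R`. -/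
lemma det_piecewise_add_one (X : Matrix ι ι ℂ) (R : Finset ι) :
    ((X + 1).submatrix (Subtype.val : R → ι) Subtype.val).det =
      ∑ S ∈ R.powerset, (X.submatrix (Subtype.val : S → ι) Subtype.val).det := by
  classical
  rw [← Matrix.det_piecewise_one_eq_submatrix_det]
  have h := (Matrix.detRowAlternating (n := ι) (R := ℂ)).toMultilinearMap.map_piecewise_add
    X.row (1 : Matrix ι ι ℂ).row R
  have h' : (Matrix.of (R.piecewise (X + 1).row (1 : Matrix ι ι ℂ).row)) =
      R.piecewise (X.row + (1 : Matrix ι ι ℂ).row) (1 : Matrix ι ι ℂ).row := rfl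
  rw [h']
  refine h.trans (Finset.sum_congr rfl fun S hS => ?_)
  rw [← Matrix.det_piecewise_one_eq_submatrix_det]
  rfl

/-- The falling factorials count the extensions of an embedding of `R` or `S` to all of `ι`. With
these weights both sides are sums over the same full embeddings, and the identity holds for each
embedding separately. -/
lemma mixedMinor_add_one (X : ι → κ → κ → ℂ) (R : Finset ι) :
    ((Fintype.card κ - R.card).descFactorial (Fintype.card ι - R.card) : ℂ) *
        mixedMinor (fun a j k => X a j k + if j = k then 1 else 0) R =
      ∑ S ∈ R.powerset,
        ((Fintype.card κ - S.card).descFactorial (Fintype.card ι - S.card) : ℂ) *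
          mixedMinor X S := by
  classical
  have key : ∀ (A : ι → κ → κ → ℂ) (S : Finset ι),
      ((Fintype.card κ - S.card).descFactorial (Fintype.card ι - S.card) : ℂ) * mixedMinor A S =
      ∑ σ : ι ↪ κ, ((Matrix.of fun a b => A a (σ a) (σ b)).submatrix
        (Subtype.val : S → ι) Subtype.val).det := by
    intro A S
    exact (sum_embedding_restrict S
      (fun σ => (Matrix.of fun a b : S => A a (σ a) (σ b)).det)).symm
  simp_rw [key]
  rw [Finset.sum_comm]
  refine Finset.sum_congr rfl fun σ _ => ?_
  rw [← det_piecewise_add_one]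
  congr 2
  ext a b
  simp [Matrix.one_apply]

/-- The principal minors on `R` expand into centred mixed minors on `S ⊆ R`. After exchanging the
sums, the coefficient of a fixed `S` depends only on `|R \ S|`, and summing it over `R ⊇ S` builds
the Laguerre polynomial. -/
lemma det_sub_gram_expansion (N : Matrix ι κ ℂ) (x : ℂ) (h : Fintype.card ι ≤ Fintype.card κ) :
    (Matrix.scalar ι x - N * Nᴴ).det =
      ∑ S : Finset ι, (-1) ^ S.card *
        laguerre (Fintype.card ι - S.card) (Fintype.card κ - S.card) x *
          mixedMinor (centredRow N) S := by
  classical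
  set p := Fintype.card ι
  set n := Fintype.card κ
  have hcard : ∀ S : Finset ι, S.card ≤ p := fun S => S.card_le_univ
  have hw : ∀ m ≤ p, ((n - m).descFactorial (p - m) : ℂ) ≠ 0 := by
    intro m hm
    have : (n - m).descFactorial (p - m) ≠ 0 := by
      rw [Ne, Nat.descFactorial_eq_zero_iff_lt]; omega
    exact_mod_cast this
  have hR : ∀ R : Finset ι, ((N * Nᴴ).submatrix (Subtype.val : R → ι) Subtype.val).det =
      mixedMinor (fun a j k => centredRow N a j k + if j = k then 1 else 0) R := by
    intro R
    have h1 : (N * Nᴴ).submatrix (Subtype.val : R → ι) Subtype.val =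
        N.submatrix (Subtype.val : R → ι) id * (N.submatrix (Subtype.val : R → ι) id)ᴴ := by
      ext a b
      simp [Matrix.mul_apply, Matrix.conjTranspose_apply]
    rw [h1, det_gram]
    simp only [mixedMinor, centredRow, centred, sub_add_cancel, Matrix.submatrix_apply, id]
  rw [det_scalar_sub]
  have hR' : ∀ R : Finset ι,
      ((N * Nᴴ).submatrix (Subtype.val : R → ι) Subtype.val).det =
      ∑ S ∈ R.powerset, ((n - R.card).descFactorial (p - R.card) : ℂ)⁻¹ *
        (((n - S.card).descFactorial (p - S.card) : ℂ) * mixedMinor (centredRow N) S) := by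
    intro R
    rw [hR, ← Finset.mul_sum, ← mixedMinor_add_one, inv_mul_cancel_left₀ (hw _ (hcard R))]
  simp_rw [hR', Finset.mul_sum]
  rw [Finset.sum_comm' (t' := Finset.univ) (s' := fun S => Finset.univ.filter (S ⊆ ·))
    (by simp)]
  refine Finset.sum_congr rfl fun S _ => ?_
  let F : ℕ → ℂ := fun k => (-1 : ℂ) ^ (S.card + k) * x ^ (p - (S.card + k)) *
      (((n - (S.card + k)).descFactorial (p - (S.card + k)) : ℂ)⁻¹ *
        (((n - S.card).descFactorial (p - S.card) : ℂ) * mixedMinor (centredRow N) S))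
  have hbij : ∑ R ∈ Finset.univ.filter (S ⊆ ·), (-1 : ℂ) ^ R.card * x ^ (p - R.card) *
      (((n - R.card).descFactorial (p - R.card) : ℂ)⁻¹ *
        (((n - S.card).descFactorial (p - S.card) : ℂ) * mixedMinor (centredRow N) S)) =
      ∑ T ∈ Sᶜ.powerset, F T.card := by
    refine Finset.sum_bij' (fun R _ => R \ S) (fun T _ => S ∪ T) ?_ ?_ ?_ ?_ ?_
    · intro R _
      simp only [Finset.mem_powerset]
      intro a ha
      simp at ha ⊢
      exact ha.2
    · intro T _
      simp
    · intro R hR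
      exact Finset.union_sdiff_of_subset (by simpa using hR)
    · intro T hT
      have : Disjoint S T := by
        rw [Finset.mem_powerset] at hT
        exact (Finset.disjoint_left.mpr fun a ha hT' => by simpa [ha] using hT hT')
      exact Finset.union_sdiff_cancel_left this
    · intro R hR
      have hc : S.card + (R \ S).card = R.card := by
        rw [add_comm]; exact Finset.card_sdiff_add_card_eq_card (by simpa using hR)
      simp only [F, hc]
  refine hbij.trans ((Finset.sum_powerset_apply_card F).trans ?_)
  simp only [F]
  rw [Finset.card_compl, laguerre, Finset.mul_sum,
    Finset.sum_mul]
  refine Finset.sum_congr rfl fun k hk => ?_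
  have hk' : S.card + k ≤ p := by
    have := hcard S
    simp at hk; omega
  -- The quotient of the extension counts for `S` and `R` is the falling factorial in the
  -- coefficient of `laguerre`.
  have hd : (n - S.card).descFactorial k * (n - (S.card + k)).descFactorial (p - (S.card + k)) =
      (n - S.card).descFactorial (p - S.card) := by
    have e1 : p - S.card = k + (p - (S.card + k)) := by omega
    have e2 : n - (S.card + k) = n - S.card - k := by omega
    rw [e2, e1, mul_comm, ← Nat.descFactorial_mul_descFactorial (Nat.le_add_right k _),
      Nat.add_sub_cancel_left]
  have e3 : p - (S.card + k) = p - S.card - k := by omega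
  rw [← hd]
  push_cast
  have := hw _ hk'
  rw [nsmul_eq_mul, pow_add]
  field_simp
  rw [e3, show Fintype.card ι = p from rfl]
  ring

end Expansion

/-! ### Counting the index patterns that survive in the second moment. -/

section Counting

open Equiv (Perm)

open scoped Nat

variable {α κ : Type*} [Fintype α] [DecidableEq α] [Fintype κ] [DecidableEq κ]

/-- The four indices at `a` all agree on `K`, are matched in parallel on `A`, and crosswise
elsewhere. -/
def Compatible (K A : Finset α) (q : (α ↪ κ) × Perm α × (α ↪ κ) × Perm α) : Prop :=
  (∀ a ∈ K, q.1 a = q.1 (q.2.1 a) ∧ q.1 a = q.2.2.1 a ∧ q.1 a = q.2.2.1 (q.2.2.2 a)) ∧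
  (∀ a ∈ A, q.1 a = q.2.2.1 a ∧ q.1 (q.2.1 a) = q.2.2.1 (q.2.2.2 a)) ∧
  (∀ a, a ∉ K → a ∉ A → q.1 a = q.2.2.1 (q.2.2.2 a) ∧ q.1 (q.2.1 a) = q.2.2.1 a)

/-- The colouring that separates the points of `K` and distinguishes `A` from the rest. -/
def classColour (K A : Finset α) (a : α) : α ⊕ Bool :=
  if a ∈ K then Sum.inl a else Sum.inr (decide (a ∈ A))

/-- Injectivity of `σ` makes `ρ` fix `K` pointwise. If `ρ` carried `a` between the parallel and
crosswise classes, the rules at `a` and at `ρ a` would both prescribe `σ (ρ a)`, and injectivity of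
`σ'` and `ρ'` would force `ρ a = a`. -/
lemma Compatible.classColour_comp {K A : Finset α} {q : (α ↪ κ) × Perm α × (α ↪ κ) × Perm α}
    (h : Compatible K A q) : classColour K A ∘ q.2.1 = classColour K A := by
  obtain ⟨σ, ρ, σ', ρ'⟩ := q
  obtain ⟨hK, hA, hB⟩ := h
  simp only at hK hA hB ⊢
  have hKρ : ∀ a ∈ K, ρ a = a := fun a ha => (σ.injective (hK a ha).1).symm
  have hsame : ∀ a, (a ∈ K ∨ a ∈ A) → σ a = σ' a := by
    rintro a (ha | ha)
    · exact (hK a ha).2.1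
    · exact (hA a ha).1
  have hKinv : ∀ a, ρ a ∈ K → a ∈ K := by
    intro a ha
    have := ρ.injective (hKρ _ ha)
    rwa [this] at ha
  ext1 a
  simp only [Function.comp, classColour]
  by_cases haK : a ∈ K
  · simp [hKρ a haK]
  have h1 : ρ a ∉ K := fun h => haK (hKinv a h)
  simp only [haK, h1, if_false, Sum.inr.injEq, decide_eq_decide]
  constructor
  · intro hρ
    by_contra haA
    have h2 := (hB a haK haA).2
    rw [hsame _ (Or.inr hρ)] at h2
    rw [σ'.injective h2] at hρ
    exact haA hρ
  · intro haA
    by_contra hρ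
    have h2 := (hA a haA).2
    rw [(hB _ h1 hρ).1] at h2
    have h3 : ρ a = a := ρ'.injective (σ'.injective h2)
    rw [h3] at hρ
    exact hρ haA

/-- At every point the rules express `σ'` and then `σ' ∘ ρ'` through `σ` and `ρ`, so the second pair
is redundant in the count. -/
lemma Compatible.injOn (K A : Finset α) :
    Set.InjOn (fun q : (α ↪ κ) × Perm α × (α ↪ κ) × Perm α => (q.1, q.2.1))
      {q | Compatible K A q} := by
  rintro ⟨σ, ρ, σ', ρ'⟩ ⟨hK, hA, hB⟩ ⟨τ, π, τ', π'⟩ ⟨hK', hA', hB'⟩ hq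
  simp only [Prod.mk.injEq] at hq hK hA hB hK' hA' hB'
  obtain ⟨rfl, rfl⟩ := hq
  have h1 : σ' = τ' := by
    ext a
    by_cases haK : a ∈ K
    · rw [← (hK a haK).2.1, ← (hK' a haK).2.1]
    by_cases haA : a ∈ A
    · rw [← (hA a haA).1, ← (hA' a haA).1]
    · rw [← (hB a haK haA).2, ← (hB' a haK haA).2]
  subst h1
  have h2 : ρ' = π' := by
    ext a
    apply σ'.injective
    by_cases haK : a ∈ K
    · rw [← (hK a haK).2.2, ← (hK' a haK).2.2]
    by_cases haA : a ∈ A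
    · rw [← (hA a haA).2, ← (hA' a haA).2]
    · rw [← (hB a haK haA).1, ← (hB' a haK haA).1]
  rw [h2]

/-- The stabilizer of a colouring is the product of the symmetric groups of its fibres, and the
fibres of the colours `Sum.inl a` have at most one point. -/
lemma card_classColour_stabilizer (K A : Finset α) :
    Fintype.card {g : Perm α // classColour K A ∘ g = classColour K A} ≤
      A.card ! * ((Finset.univ \ K) \ A).card ! := by
  rw [DomMulAct.stabilizer_card, Fintype.prod_sum_type]
  have h1 : ∏ a : α, (Fintype.card {b // classColour K A b = Sum.inl a})! = 1 := by
    refine Finset.prod_eq_one fun a _ => ?_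
    refine Nat.factorial_eq_one.mpr ?_
    refine Fintype.card_le_one_iff_subsingleton.mpr ⟨fun x y => ?_⟩
    have : ∀ x : {b // classColour K A b = Sum.inl a}, x.1 = a := by
      rintro ⟨x, hx⟩
      unfold classColour at hx
      split_ifs at hx with h
      simpa using hx
    exact Subtype.ext ((this x).trans (this y).symm)
  rw [h1, one_mul, Fintype.prod_bool]
  refine Nat.mul_le_mul (Nat.factorial_le ?_) (Nat.factorial_le ?_)
  · rw [Fintype.card_subtype]
    refine Finset.card_le_card fun a ha => ?_
    have ha := (Finset.mem_filter.mp ha).2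
    unfold classColour at ha
    split_ifs at ha with h
    simpa using ha
  · rw [Fintype.card_subtype]
    refine Finset.card_le_card fun a ha => ?_
    have ha := (Finset.mem_filter.mp ha).2
    unfold classColour at ha
    split_ifs at ha with h
    simpa [h] using ha

open Classical in
lemma card_compatible_le (K A : Finset α) :
    (Finset.univ.filter
      (Compatible (κ := κ) K A)).card ≤
      (Fintype.card κ).descFactorial (Fintype.card α) *
        (A.card ! * ((Finset.univ \ K) \ A).card !) := by
  have h1 := Finset.card_le_card_of_injOn
    (s := Finset.univ.filter (Compatible (κ := κ) K A))
    (t := (Finset.univ : Finset (α ↪ κ)) ×ˢ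
      (Finset.univ.filter fun g : Perm α => classColour K A ∘ g = classColour K A))
    (fun q => (q.1, q.2.1))
    (by
      intro q hq
      simpa using Compatible.classColour_comp (by simpa using hq))
    (by
      have := Compatible.injOn (κ := κ) K A
      intro x hx y hy
      exact this (by simpa using hx) (by simpa using hy))
  refine h1.trans ?_
  rw [Finset.card_product, Finset.card_univ, Fintype.card_embedding_eq]
  refine Nat.mul_le_mul_left _ ?_
  rw [← Fintype.card_subtype]
  exact card_classColour_stabilizer K A

lemma sum_powerset_factorial (T : Finset α) :
    ∑ A ∈ T.powerset, (A.card ! * (T \ A).card ! : ℝ) = (T.card + 1)! := by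
  have h : ∑ A ∈ T.powerset, (A.card ! * (T \ A).card ! : ℝ) =
      ∑ A ∈ T.powerset, (fun k => (k ! * (T.card - k)! : ℝ)) A.card := by
    refine Finset.sum_congr rfl fun A hA => ?_
    rw [Finset.card_sdiff_of_subset (Finset.mem_powerset.mp hA)]
  rw [h, Finset.sum_powerset_apply_card (fun k => (k ! * (T.card - k)! : ℝ))]
  have h2 : ∀ k ∈ Finset.range (T.card + 1),
      T.card.choose k • ((k ! * (T.card - k)! : ℝ)) = T.card ! := by
    intro k hk
    have := Nat.choose_mul_factorial_mul_factorial (n := T.card) (k := k)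
      (by simpa [Nat.lt_succ_iff] using hk)
    rw [nsmul_eq_mul, ← mul_assoc]
    exact_mod_cast this
  rw [Finset.sum_congr rfl h2]
  simp [Nat.factorial_succ]

/-- Since `C(m,k) (m-k+1)! ≤ (m+1)!/k!`, the sum is dominated by a partial sum of the exponential
series. -/
lemma sum_powerset_pow_mul_factorial_le {b : ℝ} (hb : 0 ≤ b) :
    ∑ K ∈ (Finset.univ : Finset α).powerset,
      b ^ K.card * ((Finset.univ \ K).card + 1)! ≤ (Fintype.card α + 1)! * Real.exp b := by
  set m := Fintype.card α
  have h : ∑ K ∈ (Finset.univ : Finset α).powerset,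
      b ^ K.card * ((Finset.univ \ K).card + 1)! =
      ∑ K ∈ (Finset.univ : Finset α).powerset,
        (fun k => b ^ k * ((m - k + 1)! : ℝ)) K.card := by
    refine Finset.sum_congr rfl fun A hA => ?_
    rw [Finset.card_sdiff_of_subset (Finset.mem_powerset.mp hA), Finset.card_univ]
  rw [h, Finset.sum_powerset_apply_card (fun k => b ^ k * ((m - k + 1)! : ℝ)), Finset.card_univ]
  have h2 : ∀ k ∈ Finset.range (m + 1),
      m.choose k • (b ^ k * ((m - k + 1)! : ℝ)) ≤ (m + 1)! * (b ^ k / k !) := by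
    intro k hk
    have hk' : k ≤ m := by simpa [Nat.lt_succ_iff] using hk
    have h3 := Nat.choose_mul_factorial_mul_factorial hk'
    have h4 : m.choose k * k ! * (m - k + 1)! ≤ (m + 1)! := by
      rw [Nat.factorial_succ, Nat.factorial_succ m, ← h3]
      have : m - k + 1 ≤ m + 1 := by omega
      calc m.choose k * k ! * ((m - k + 1) * (m - k)!)
          = (m - k + 1) * (m.choose k * k ! * (m - k)!) := by ring
        _ ≤ (m + 1) * (m.choose k * k ! * (m - k)!) := Nat.mul_le_mul_right _ this
    have h5 : (m.choose k * k ! * (m - k + 1)! : ℝ) ≤ (m + 1)! := by exact_mod_cast h4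
    have h6 : (0 : ℝ) < k ! := by positivity
    rw [nsmul_eq_mul, mul_div_assoc', le_div_iff₀ h6]
    calc (m.choose k : ℝ) * (b ^ k * ((m - k + 1)! : ℝ)) * k !
        = b ^ k * (m.choose k * k ! * (m - k + 1)!) := by ring
      _ ≤ b ^ k * (m + 1)! := by gcongr
      _ = (m + 1)! * b ^ k := by ring
  refine (Finset.sum_le_sum h2).trans ?_
  rw [← Finset.mul_sum]
  gcongr
  exact Real.sum_le_exp_of_nonneg hb _

/-- The bound for the covariance of two entries of a centred rank-one matrix. -/
def covBound (b : ℝ) (j k j' k' : κ) : ℝ :=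
  (if j = k ∧ j = j' ∧ j = k' then b else 0) +
    ((if j = j' ∧ k = k' then 1 else 0) + if j = k' ∧ k = j' then 1 else 0)

/-- Expanding the product selects one of the three terms of `covBound` at each point: `K` collects
the points with four equal indices, `A` the parallel matchings, and the rest is crosswise. For each
choice the nonzero terms are the compatible quadruples. -/
lemma sum_prod_covBound_le {b : ℝ} (hb : 0 ≤ b) :
    ∑ q : (α ↪ κ) × Perm α × (α ↪ κ) × Perm α,
      ∏ a, covBound b (q.1 a) (q.1 (q.2.1 a)) (q.2.2.1 a) (q.2.2.1 (q.2.2.2 a)) ≤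
      (Fintype.card κ).descFactorial (Fintype.card α) *
        ((Fintype.card α + 1)! * Real.exp b) := by
  classical
  have h1 : ∀ q : (α ↪ κ) × Perm α × (α ↪ κ) × Perm α,
      ∏ a, covBound b (q.1 a) (q.1 (q.2.1 a)) (q.2.2.1 a) (q.2.2.1 (q.2.2.2 a)) =
      ∑ K ∈ (Finset.univ : Finset α).powerset, ∑ A ∈ (Finset.univ \ K).powerset,
        if Compatible K A q then b ^ K.card else 0 := by
    intro q
    simp only [covBound]
    rw [Finset.prod_add]
    refine Finset.sum_congr rfl fun K _ => ?_
    rw [Finset.prod_add, Finset.mul_sum]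
    refine Finset.sum_congr rfl fun A _ => ?_
    rw [Finset.prod_ite_zero, Finset.prod_ite_zero, Finset.prod_ite_zero]
    simp only [Finset.prod_const, one_pow, Finset.mem_sdiff, Finset.mem_univ, true_and, and_imp]
    by_cases hc : Compatible K A q
    · rw [if_pos hc, if_pos hc.1, if_pos hc.2.1, if_pos hc.2.2, mul_one, mul_one]
    · rw [if_neg hc]
      split_ifs with h1 h2 h3
      · exact absurd ⟨h1, h2, h3⟩ hc
      all_goals simp only [mul_zero, zero_mul]
  simp_rw [h1]
  rw [Finset.sum_comm]
  have h2 : ∀ K ∈ (Finset.univ : Finset α).powerset,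
      ∑ q : (α ↪ κ) × Perm α × (α ↪ κ) × Perm α, ∑ A ∈ (Finset.univ \ K).powerset,
        (if Compatible K A q then b ^ K.card else 0) ≤
      (Fintype.card κ).descFactorial (Fintype.card α) *
        (b ^ K.card * ((Finset.univ \ K).card + 1)!) := by
    intro K _
    rw [Finset.sum_comm, ← sum_powerset_factorial, Finset.mul_sum, Finset.mul_sum]
    refine Finset.sum_le_sum fun A _ => ?_
    rw [← Finset.sum_filter, Finset.sum_const, nsmul_eq_mul]
    have h3 : ((Finset.univ.filter (Compatible (κ := κ) K A)).card : ℝ) ≤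
      (Fintype.card κ).descFactorial (Fintype.card α) *
        (A.card ! * ((Finset.univ \ K) \ A).card !) := by
      exact_mod_cast card_compatible_le (κ := κ) K A
    calc _ ≤ ((Fintype.card κ).descFactorial (Fintype.card α) *
        (A.card ! * ((Finset.univ \ K) \ A).card !) : ℝ) * b ^ K.card := by gcongr
      _ = _ := by ring
  refine (Finset.sum_le_sum h2).trans ?_
  rw [← Finset.mul_sum]
  exact mul_le_mul_of_nonneg_left (sum_powerset_pow_mul_factorial_le hb) (Nat.cast_nonneg _)

end Counting

/-! ### Covariances of the centred rank-one entries within a row. -/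

section Moments

variable {Ω : Type*} [MeasurableSpace Ω] {P : Measure Ω}
variable {ι κ : Type*} [Fintype ι] [DecidableEq ι] [Fintype κ] [DecidableEq κ]

/-- Independent entries with mean zero, unit variance and fourth moment at most `β`. -/
structure StandardEntries (P : Measure Ω) (M : Ω → ι → κ → ℂ) (β : ℝ) : Prop where
  meas : ∀ i j, Measurable (fun ω => M ω i j)
  indep : iIndepFun (fun (ij : ι × κ) ω => M ω ij.1 ij.2) P
  mean : ∀ i j, ∫ ω, M ω i j ∂P = 0
  var : ∀ i j, ∫ ω, ‖M ω i j‖ ^ 2 ∂P = 1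
  fourth_integrable : ∀ i j, Integrable (fun ω => ‖M ω i j‖ ^ 4) P
  fourth_le : ∀ i j, ∫ ω, ‖M ω i j‖ ^ 4 ∂P ≤ β

variable {M : Ω → ι → κ → ℂ} {β : ℝ}

lemma measurable_centred (j k : κ) : Measurable (centred j k) := by
  unfold centred
  fun_prop

lemma StandardEntries.measurable_row (h : StandardEntries P M β) (i : ι) :
    Measurable (fun ω => M ω i) :=
  measurable_pi_iff.mpr fun j => h.meas i j

lemma StandardEntries.iIndepFun_row (h : StandardEntries P M β) (i : ι) :
    iIndepFun (fun j ω => M ω i j) P :=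
  h.indep.precomp (g := fun j : κ => (i, j)) (fun _ _ h => (Prod.mk.inj h).2)

lemma StandardEntries.iIndepFun_rows (h : StandardEntries P M β) :
    iIndepFun (fun i ω => M ω i) P := by
  have hP : IsProbabilityMeasure P := h.indep.isProbabilityMeasure
  have h' : iIndepFun (fun (q : Σ _ : ι, κ) ω => M ω q.1 q.2) P :=
    h.indep.precomp (Equiv.sigmaEquivProd ι κ).injective
  have mX : ∀ i j, Measurable (fun ω => M ω i j) := h.meas
  have : ∀ i j, IsProbabilityMeasure (P.map (fun ω => M ω i j)) :=
    fun i j => Measure.isProbabilityMeasure_map (mX i j).aemeasurable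
  have hrow := h.measurable_row
  rw [iIndepFun_iff_map_fun_eq_infinitePi_map hrow]
  have e : (fun ω i => M ω i) = (MeasurableEquiv.piCurry (fun (_ : ι) (_ : κ) => ℂ)) ∘
      (fun ω (q : Σ _ : ι, κ) => M ω q.1 q.2) := by
    ext; simp [Sigma.curry]
  have hX : Measurable (fun ω (q : Σ _ : ι, κ) => M ω q.1 q.2) :=
    measurable_pi_iff.mpr fun q => mX q.1 q.2
  rw [e, ← Measure.map_map (by fun_prop) hX,
    iIndepFun.map_fun_eq_infinitePi_map (X := fun (q : Σ _ : ι, κ) ω => M ω q.1 q.2)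
      (fun q => mX q.1 q.2) h',
    Measure.infinitePi_map_piCurry (fun i j => P.map (fun ω => M ω i j))]
  congr 1
  ext1 i
  exact ((iIndepFun_iff_map_fun_eq_infinitePi_map (mX i)).1 (h.iIndepFun_row i)).symm

lemma StandardEntries.integral_prod_rows (h : StandardEntries P M β) {F : ι → (κ → ℂ) → ℂ}
    (hF : ∀ i, Measurable (F i)) :
    ∫ ω, ∏ i, F i (M ω i) ∂P = ∏ i, ∫ ω, F i (M ω i) ∂P :=
  h.iIndepFun_rows.integral_fun_prod_comp (fun i => (h.measurable_row i).aemeasurable)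
    (fun i => (hF i).aestronglyMeasurable)

lemma StandardEntries.integrable_prod_rows (h : StandardEntries P M β) {F : ι → (κ → ℂ) → ℂ}
    (hF : ∀ i, Measurable (F i)) (hInt : ∀ i, Integrable (fun ω => F i (M ω i)) P) :
    Integrable (fun ω => ∏ i, F i (M ω i)) P := by
  have hP : IsProbabilityMeasure P := h.indep.isProbabilityMeasure
  have hrow := h.measurable_row
  have : ∀ i, IsProbabilityMeasure (P.map (fun ω => M ω i)) :=
    fun i => Measure.isProbabilityMeasure_map (hrow i).aemeasurable
  have h1 : Integrable (fun x : ι → κ → ℂ => ∏ i, F i (x i))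
      (Measure.pi fun i => P.map (fun ω => M ω i)) :=
    Integrable.fintype_prod fun i =>
      (integrable_map_measure (hF i).aestronglyMeasurable (hrow i).aemeasurable).mpr (hInt i)
  rw [← h.iIndepFun_rows.map_fun_eq_pi_map (fun i => (hrow i).aemeasurable)] at h1
  exact h1.comp_measurable (measurable_pi_iff.mpr hrow)

/-- One coordinate of a row is independent of a function of the other coordinates. -/
lemma StandardEntries.integral_coord_mul (h : StandardEntries P M β) (i : ι) (l : κ) {g : ℂ → ℂ}
    (hg : Measurable g) {Z : (κ → ℂ) → ℂ} (hZ : Measurable Z)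
    (hZl : ∀ v, Z (Function.update v l 0) = Z v) :
    ∫ ω, g (M ω i l) * Z (M ω i) ∂P = (∫ ω, g (M ω i l) ∂P) * ∫ ω, Z (M ω i) ∂P := by
  have hind := (h.iIndepFun_row i).indepFun_finset {l} (Finset.univ.erase l) (by simp) (h.meas i)
  -- Filling coordinate `l` with 0 writes `Z` as a function of the other coordinates; by `hZl` this
  -- does not change its value.
  let ext : ({j // j ∈ Finset.univ.erase l} → ℂ) → (κ → ℂ) := fun w j =>
    if hj : j = l then 0 else w ⟨j, by simp [hj]⟩
  have hext : Measurable ext := by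
    refine measurable_pi_iff.mpr fun j => ?_
    by_cases hj : j = l
    · simp [ext, hj]
    · simp only [ext, hj, dite_false]
      fun_prop
  have h2 := hind.comp (φ := fun w : {j // j ∈ ({l} : Finset κ)} → ℂ => g (w ⟨l, by simp⟩)) (ψ := Z ∘ ext)
    (hg.comp (measurable_pi_apply _)) (hZ.comp hext)
  have h3 : ∀ ω, (Z ∘ ext) (fun j => M ω i j) = Z (M ω i) := by
    intro ω
    rw [← hZl (M ω i)]
    simp only [Function.comp]
    congr 1
    ext j
    by_cases hj : j = l
    · subst hj; simp [ext]
    · simp [ext, hj]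
  have hm1 : Measurable (fun ω => g (M ω i l)) := hg.comp (h.meas i l)
  have hm2 : Measurable (fun ω => Z (M ω i)) := hZ.comp (h.measurable_row i)
  have h4 : IndepFun (fun ω => g (M ω i l)) (fun ω => Z (M ω i)) P := by
    have e : (fun ω => Z (M ω i)) = (Z ∘ ext) ∘
        (fun ω => fun j : {j // j ∈ Finset.univ.erase l} => M ω i j) :=
      funext fun ω => (h3 ω).symm
    rw [e]
    exact h2
  exact h4.integral_fun_mul_eq_mul_integral hm1.aestronglyMeasurable hm2.aestronglyMeasurable

lemma StandardEntries.integral_self_mul_eq_zero (h : StandardEntries P M β) (i : ι) (l : κ)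
    {Z : (κ → ℂ) → ℂ} (hZ : Measurable Z) (hZl : ∀ v, Z (Function.update v l 0) = Z v) :
    ∫ ω, M ω i l * Z (M ω i) ∂P = 0 := by
  have := h.integral_coord_mul i l measurable_id hZ hZl
  simpa [h.mean i l] using this

lemma StandardEntries.integral_star_mul_eq_zero (h : StandardEntries P M β) (i : ι) (l : κ)
    {Z : (κ → ℂ) → ℂ} (hZ : Measurable Z) (hZl : ∀ v, Z (Function.update v l 0) = Z v) :
    ∫ ω, star (M ω i l) * Z (M ω i) ∂P = 0 := by
  have := h.integral_coord_mul i l (g := star) (by fun_prop) hZ hZl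
  have h0 : ∫ ω, star (M ω i l) ∂P = 0 := by
    have := integral_conj (μ := P) (f := fun ω => M ω i l)
    rw [h.mean i l] at this
    simpa using this
  rw [this, h0, zero_mul]

lemma StandardEntries.integrable_sq (h : StandardEntries P M β) (i : ι) (j : κ) :
    Integrable (fun ω => ‖M ω i j‖ ^ 2) P := by
  -- The integral of a non-integrable function is 0 by convention, which contradicts the unit second
  -- moment.
  by_contra hn
  have := h.var i j
  rw [integral_undef hn] at this
  exact zero_ne_one this

lemma mul_star_eq_norm_sq (z : ℂ) : z * star z = ((‖z‖ ^ 2 : ℝ) : ℂ) := by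
  rw [Complex.star_def, Complex.mul_conj, Complex.normSq_eq_norm_sq]

lemma StandardEntries.integral_mul_star (h : StandardEntries P M β) (i : ι) (j : κ) :
    ∫ ω, M ω i j * star (M ω i j) ∂P = 1 := by
  simp_rw [mul_star_eq_norm_sq]
  rw [integral_complex_ofReal, h.var i j, Complex.ofReal_one]

lemma StandardEntries.integral_centred_diag (h : StandardEntries P M β) (i : ι) (j : κ) :
    ∫ ω, (M ω i j * star (M ω i j) - 1) ∂P = 0 := by
  have hP : IsProbabilityMeasure P := h.indep.isProbabilityMeasure
  rw [integral_sub _ (integrable_const _), h.integral_mul_star i j]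
  · simp
  · simp_rw [mul_star_eq_norm_sq]
    exact (h.integrable_sq i j).ofReal

lemma StandardEntries.integral_centred (h : StandardEntries P M β) (i : ι) (j k : κ) :
    ∫ ω, centred j k (M ω i) ∂P = 0 := by
  by_cases hjk : j = k
  · subst hjk
    simpa [centred] using h.integral_centred_diag i j
  · simp only [centred, hjk, if_false, sub_zero]
    exact h.integral_self_mul_eq_zero i j (Z := fun v => star (v k)) (by fun_prop)
      (fun v => by simp [Function.update_of_ne (Ne.symm hjk)])

lemma norm_centred_mul_star_le (j k j' k' : κ) (v : κ → ℂ) :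
    ‖centred j k v * star (centred j' k' v)‖ ≤
      ‖v j‖ ^ 4 + ‖v k‖ ^ 4 + (‖v j'‖ ^ 4 + ‖v k'‖ ^ 4) + 2 := by
  have key : ∀ j k : κ, ‖centred j k v‖ ≤ ‖v j‖ * ‖v k‖ + 1 := by
    intro j k
    unfold centred
    refine (norm_sub_le _ _).trans ?_
    rw [norm_mul, norm_star]
    split_ifs <;> simp
  have h1 := key j k
  have h2 := key j' k'
  rw [norm_mul, norm_star]
  set x := ‖v j‖
  set y := ‖v k‖
  set x' := ‖v j'‖
  set y' := ‖v k'‖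
  have h3 : ‖centred j k v‖ * ‖centred j' k' v‖ ≤ (x * y + 1) * (x' * y' + 1) := by
    have : 0 ≤ x * y + 1 := by positivity
    gcongr
  refine h3.trans ?_
  have a1 : 2 * (x * y) ^ 2 ≤ x ^ 4 + y ^ 4 := by nlinarith [sq_nonneg (x ^ 2 - y ^ 2)]
  have a2 : 2 * (x' * y') ^ 2 ≤ x' ^ 4 + y' ^ 4 := by nlinarith [sq_nonneg (x' ^ 2 - y' ^ 2)]
  nlinarith [sq_nonneg (x * y - x' * y'), sq_nonneg (x * y - 1), sq_nonneg (x' * y' - 1)]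

lemma StandardEntries.integrable_centred_mul_star (h : StandardEntries P M β) (i : ι)
    (j k j' k' : κ) :
    Integrable (fun ω => centred j k (M ω i) * star (centred j' k' (M ω i))) P := by
  have hP : IsProbabilityMeasure P := h.indep.isProbabilityMeasure
  have hm : Measurable (fun v : κ → ℂ => centred j k v * star (centred j' k' v)) := by
    have := measurable_centred j k
    have := measurable_centred j' k'
    fun_prop
  have h4 := h.fourth_integrable i
  exact ((((h4 j).add (h4 k)).add ((h4 j').add (h4 k'))).add (integrable_const 2)).mono'
    (hm.comp (h.measurable_row i)).aestronglyMeasurable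
    (ae_of_all _ fun ω => norm_centred_mul_star_le j k j' k' (M ω i))

lemma covBound_nonneg {b : ℝ} (hb : 0 ≤ b) (j k j' k' : κ) : 0 ≤ covBound b j k j' k' := by
  unfold covBound
  split_ifs <;> linarith

lemma StandardEntries.integral_sq_sub_one_sq (h : StandardEntries P M β) (i : ι) (j : κ) :
    ∫ ω, (‖M ω i j‖ ^ 2 - 1) ^ 2 ∂P = (∫ ω, ‖M ω i j‖ ^ 4 ∂P) - 1 := by
  have hP : IsProbabilityMeasure P := h.indep.isProbabilityMeasure
  have e : ∀ ω, (‖M ω i j‖ ^ 2 - 1) ^ 2 = ‖M ω i j‖ ^ 4 - 2 * ‖M ω i j‖ ^ 2 + 1 := by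
    intro ω; ring
  simp_rw [e]
  have h2 := h.integrable_sq i j
  have h4 := h.fourth_integrable i j
  have h3 := h2.const_mul 2
  have h5 := integral_add (h4.sub h3) (integrable_const (1 : ℝ))
  simp only [Pi.sub_apply] at h5
  rw [h5, integral_sub h4 h3, integral_const_mul, h.var i j]
  simp
  ring

/-- The variance of `|t|²` is nonnegative. This makes `β - 1` an admissible parameter of `covBound`.
-/
lemma StandardEntries.one_le (h : StandardEntries P M β) (i : ι) (j : κ) : 1 ≤ β := by
  have h1 := h.integral_sq_sub_one_sq i j
  have h2 : 0 ≤ ∫ ω, (‖M ω i j‖ ^ 2 - 1) ^ 2 ∂P := integral_nonneg fun ω => sq_nonneg _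
  linarith [h.fourth_le i j]

lemma StandardEntries.norm_integral_sq_le (h : StandardEntries P M β) (i : ι) (j : κ) :
    ‖∫ ω, M ω i j ^ 2 ∂P‖ ≤ 1 := by
  refine (norm_integral_le_integral_norm _).trans ?_
  simp_rw [norm_pow]
  exact (h.var i j).le

/-- Unless the indices pair up, some coordinate enters only through one factor of mean zero and the
covariance vanishes. Of the remaining patterns, four equal indices give the variance of `|t|²`, at
most `β - 1`; a parallel off-diagonal pair gives exactly 1; a crossed pair gives a product of two
second moments `E t²` and `E t̄²`, each of modulus at most 1. -/
lemma StandardEntries.norm_integral_centred_mul_star_le (h : StandardEntries P M β) (i : ι)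
    (j k j' k' : κ) :
    ‖∫ ω, centred j k (M ω i) * star (centred j' k' (M ω i)) ∂P‖ ≤
      covBound (β - 1) j k j' k' := by
  have hb : 0 ≤ β - 1 := by linarith [h.one_le i j]
  have hnn := covBound_nonneg hb j k j' k'
  have hzero : (∫ ω, centred j k (M ω i) * star (centred j' k' (M ω i)) ∂P) = 0 →
      ‖∫ ω, centred j k (M ω i) * star (centred j' k' (M ω i)) ∂P‖ ≤
      covBound (β - 1) j k j' k' := by
    intro h0
    rw [h0, norm_zero]
    exact hnn
  have hne : ∀ {a b : κ}, a ≠ b → ∀ v : κ → ℂ, Function.update v a 0 b = v b :=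
    fun hab v => Function.update_of_ne (Ne.symm hab) _ _
  by_cases hjk : j = k
  · subst hjk
    by_cases hjk' : j' = k'
    · subst hjk'
      by_cases hjj : j = j'
      · subst hjj
        have e : ∀ ω, centred j j (M ω i) * star (centred j j (M ω i)) =
            (((‖M ω i j‖ ^ 2 - 1) ^ 2 : ℝ) : ℂ) := by
          intro ω
          simp only [centred, if_true, mul_star_eq_norm_sq]
          rw [← Complex.ofReal_one, ← Complex.ofReal_sub, Complex.norm_real, Real.norm_eq_abs,
            sq_abs]
        simp_rw [e]
        rw [integral_complex_ofReal, h.integral_sq_sub_one_sq i j, Complex.norm_real, Real.norm_eq_abs,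
          abs_of_nonneg]
        · simp only [covBound, and_self, if_true]
          linarith [h.fourth_le i j]
        · rw [← h.integral_sq_sub_one_sq i j]
          exact integral_nonneg fun ω => sq_nonneg _
      · apply hzero
        have := h.integral_coord_mul i j (g := fun z => z * star z - 1)
          (Z := fun v => star (centred j' j' v)) (by fun_prop)
          (by have := measurable_centred j' j'; fun_prop)
          (fun v => by simp [centred, hne hjj])
        simp only [h.integral_centred_diag i j, zero_mul] at this
        simpa [centred] using this
    · apply hzero
      -- As `j' ≠ k'`, at least one of them differs from `j`; that index occurs alone and its
      -- coordinate is factored out.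
      by_cases hjj : j = j'
      · have hjk2 : k' ≠ j := fun e => hjk' (hjj ▸ e.symm)
        have := h.integral_self_mul_eq_zero i k'
          (Z := fun v => centred j j v * star (v j'))
          (by have := measurable_centred j j; fun_prop)
          (fun v => by simp [centred, hne hjk2, hne (Ne.symm hjk')])
        rw [← this]
        congr 1
        ext ω
        simp only [centred, hjk', if_false, sub_zero, star_mul', star_star]
        ring
      · have := h.integral_star_mul_eq_zero i j'
          (Z := fun v => centred j j v * v k')
          (by have := measurable_centred j j; fun_prop)
          (fun v => by simp [centred, hne (Ne.symm hjj), hne hjk'])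
        rw [← this]
        congr 1
        ext ω
        simp only [centred, hjk', if_false, sub_zero, star_mul', star_star]
        ring
  by_cases hjk' : j' = k'
  · subst hjk'
    apply hzero
    by_cases hjj : j = j'
    · have hkj : k ≠ j' := fun e => hjk (hjj.trans e.symm)
      have := h.integral_star_mul_eq_zero i k
        (Z := fun v => v j * star (centred j' j' v))
        (by have := measurable_centred j' j'; fun_prop)
        (fun v => by simp [centred, hne hkj, hne (Ne.symm hjk)])
      rw [← this]
      congr 1
      ext ω
      simp only [centred, hjk, if_false, sub_zero]
      ring
    · have := h.integral_self_mul_eq_zero i j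
        (Z := fun v => star (v k) * star (centred j' j' v))
        (by have := measurable_centred j' j'; fun_prop)
        (fun v => by simp [centred, hne hjj, hne hjk])
      rw [← this]
      congr 1
      ext ω
      simp only [centred, hjk, if_false, sub_zero]
      ring
  have e : ∀ ω, centred j k (M ω i) * star (centred j' k' (M ω i)) =
      M ω i j * (star (M ω i k) * star (M ω i j') * M ω i k') := by
    intro ω
    simp only [centred, hjk, hjk', if_false, sub_zero, star_mul', star_star]
    ring
  by_cases h1 : j = j'
  · subst h1
    by_cases h2 : k = k'
    · subst h2
      have := h.integral_coord_mul i j (g := fun z => z * star z)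
        (Z := fun v => v k * star (v k)) (by fun_prop) (by fun_prop)
        (fun v => by simp [hne hjk])
      rw [h.integral_mul_star i j, h.integral_mul_star i k, one_mul] at this
      have e2 : (∫ ω, centred j k (M ω i) * star (centred j k (M ω i)) ∂P) = 1 := by
        rw [← this]
        congr 1
        ext ω
        rw [e ω]
        ring
      rw [e2, norm_one]
      simp only [covBound, and_self, if_true]
      split_ifs <;> linarith
    · apply hzero
      have := h.integral_star_mul_eq_zero i k
        (Z := fun v => v j * star (v j) * v k') (by fun_prop)
        (fun v => by simp [hne (Ne.symm hjk), hne h2])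
      rw [← this]
      congr 1
      ext ω
      rw [e ω]
      ring
  by_cases h2 : j = k'
  · subst h2
    by_cases h3 : k = j'
    · subst h3
      have := h.integral_coord_mul i j (g := fun z => z ^ 2)
        (Z := fun v => star (v k) ^ 2) (by fun_prop) (by fun_prop)
        (fun v => by simp [hne hjk])
      have e2 : (∫ ω, centred j k (M ω i) * star (centred k j (M ω i)) ∂P) =
          (∫ ω, M ω i j ^ 2 ∂P) * ∫ ω, star (M ω i k) ^ 2 ∂P := by
        rw [← this]
        congr 1
        ext ω
        rw [e ω]
        ring
      have e3 : ‖∫ ω, star (M ω i k) ^ 2 ∂P‖ ≤ 1 := by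
        refine (norm_integral_le_integral_norm _).trans ?_
        simp_rw [norm_pow, norm_star]
        exact (h.var i k).le
      rw [e2, norm_mul]
      refine (mul_le_one₀ (h.norm_integral_sq_le i j) (norm_nonneg _) e3).trans ?_
      simp only [covBound, and_self, if_true]
      split_ifs <;> linarith
    · apply hzero
      have := h.integral_star_mul_eq_zero i k
        (Z := fun v => v j * star (v j') * v j) (by fun_prop)
        (fun v => by simp [hne (Ne.symm hjk), hne h3])
      rw [← this]
      congr 1
      ext ω
      rw [e ω]
      ring
  · apply hzero
    have := h.integral_self_mul_eq_zero i j
      (Z := fun v => star (v k) * star (v j') * v k') (by fun_prop)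
      (fun v => by simp [hne hjk, hne h1, hne h2])
    rw [← this]
    congr 1
    ext ω
    rw [e ω]

end Moments

/-! ### Orthogonality of the mixed minors and the second moment of the determinant. -/

section SecondMoment

open Equiv (Perm)

open scoped Nat

variable {Ω : Type*} [MeasurableSpace Ω] {P : Measure Ω}
variable {ι κ : Type*} [Fintype ι] [DecidableEq ι] [Fintype κ] [DecidableEq κ]
variable {M : Ω → ι → κ → ℂ} {β : ℝ}

/-- The factor of a monomial of `mixedMinor (centredRow N) S` coming from row `i`. -/
noncomputable def rowTerm (S : Finset ι) (q : (S ↪ κ) × Perm S) (i : ι) (v : κ → ℂ) : ℂ :=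
  if h : i ∈ S then centred (q.1 ⟨i, h⟩) (q.1 (q.2 ⟨i, h⟩)) v else 1

/-- A monomial of `mixedMinor (centredRow N) S`. -/
noncomputable def minorTerm (S : Finset ι) (q : (S ↪ κ) × Perm S) (N : ι → κ → ℂ) : ℂ :=
  ∏ i, rowTerm S q i (N i)

lemma measurable_rowTerm (S : Finset ι) (q : (S ↪ κ) × Perm S) (i : ι) :
    Measurable (rowTerm S q i) := by
  unfold rowTerm
  split_ifs with h
  · exact measurable_centred _ _
  · exact measurable_const

lemma prod_dite_mem {A : Type*} [CommMonoid A] (S : Finset ι) (f : S → A) :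
    ∏ i : ι, (if h : i ∈ S then f ⟨i, h⟩ else 1) = ∏ a : S, f a := by
  have h1 : ∏ a : S, f a = ∏ a : S, (fun i => if h : i ∈ S then f ⟨i, h⟩ else 1) a :=
    Finset.prod_congr rfl fun a _ => by simp
  rw [h1, Finset.prod_coe_sort S (fun i => if h : i ∈ S then f ⟨i, h⟩ else 1)]
  refine (Finset.prod_subset (Finset.subset_univ S) fun i _ hi => ?_).symm
  simp [hi]

lemma mixedMinor_eq_sum_minorTerm (N : ι → κ → ℂ) (S : Finset ι) :
    mixedMinor (centredRow N) S =
      ∑ q : (S ↪ κ) × Perm S, ((Perm.sign q.2 : ℤ) : ℂ) * minorTerm S q N := by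
  rw [Fintype.sum_prod_type, mixedMinor]
  refine Finset.sum_congr rfl fun σ _ => ?_
  -- The transpose makes the Leibniz product run over rows, so that each factor involves a single
  -- row of `N`.
  rw [← Matrix.det_transpose, Matrix.det_apply']
  refine Finset.sum_congr rfl fun ρ _ => ?_
  congr 1
  exact (prod_dite_mem S (fun a => centred (σ a) (σ (ρ a)) (N a))).symm

lemma StandardEntries.integrable_rowTerm_mul_star (h : StandardEntries P M β) (S S' : Finset ι)
    (q : (S ↪ κ) × Perm S) (q' : (S' ↪ κ) × Perm S') (i : ι) :
    Integrable (fun ω => rowTerm S q i (M ω i) * star (rowTerm S' q' i (M ω i))) P := by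
  have hP : IsProbabilityMeasure P := h.indep.isProbabilityMeasure
  have h1 : ∀ j k, Integrable (fun ω => centred j k (M ω i)) P := by
    intro j k
    have hL2 : MemLp (fun ω => centred j k (M ω i)) 2 P := by
      rw [memLp_two_iff_integrable_sq_norm]
      · refine (h.integrable_centred_mul_star i j k j k).norm.congr (ae_of_all _ fun ω => ?_)
        simp [sq]
      · exact ((measurable_centred j k).comp (h.measurable_row i)).aestronglyMeasurable
    exact hL2.integrable (by norm_num)
  unfold rowTerm
  split_ifs with h2 h3 h3
  · exact h.integrable_centred_mul_star i _ _ _ _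
  · simpa using h1 _ _
  · have := (Complex.conjCLE : ℂ →L[ℝ] ℂ).integrable_comp
      (h1 (q'.1 ⟨i, h3⟩) (q'.1 (q'.2 ⟨i, h3⟩)))
    simpa using this
  · simp

lemma StandardEntries.integrable_minorTerm_mul_star (h : StandardEntries P M β) (S S' : Finset ι)
    (q : (S ↪ κ) × Perm S) (q' : (S' ↪ κ) × Perm S') :
    Integrable (fun ω => minorTerm S q (M ω) * star (minorTerm S' q' (M ω))) P := by
  have := h.integrable_prod_rows (F := fun i v => rowTerm S q i v * star (rowTerm S' q' i v))
    (fun i => (measurable_rowTerm S q i).mul (continuous_star.measurable.comp (measurable_rowTerm S' q' i)))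
    (h.integrable_rowTerm_mul_star S S' q q')
  refine this.congr (ae_of_all _ fun ω => ?_)
  simp only [minorTerm, Finset.prod_mul_distrib, star_prod]

lemma StandardEntries.integral_minorTerm_mul_star (h : StandardEntries P M β) (S S' : Finset ι)
    (q : (S ↪ κ) × Perm S) (q' : (S' ↪ κ) × Perm S') :
    ∫ ω, minorTerm S q (M ω) * star (minorTerm S' q' (M ω)) ∂P =
      ∏ i, ∫ ω, rowTerm S q i (M ω i) * star (rowTerm S' q' i (M ω i)) ∂P := by
  rw [← h.integral_prod_rows (F := fun i v => rowTerm S q i v * star (rowTerm S' q' i v))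
    (fun i => (measurable_rowTerm S q i).mul (continuous_star.measurable.comp (measurable_rowTerm S' q' i)))]
  simp only [minorTerm, Finset.prod_mul_distrib, star_prod]

/-- A row in exactly one of `S`, `S'` contributes a single centred entry, of mean zero, to the
product over rows. -/
lemma StandardEntries.integral_minorTerm_mul_star_of_ne (h : StandardEntries P M β)
    {S S' : Finset ι} (hS : S ≠ S') (q : (S ↪ κ) × Perm S) (q' : (S' ↪ κ) × Perm S') :
    ∫ ω, minorTerm S q (M ω) * star (minorTerm S' q' (M ω)) ∂P = 0 := by
  rw [h.integral_minorTerm_mul_star]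
  have hex : ∃ i, (i ∈ S ∧ i ∉ S') ∨ (i ∉ S ∧ i ∈ S') := by
    by_contra hn
    push Not at hn
    apply hS
    ext i
    have := hn i
    tauto
  obtain ⟨i, hi⟩ := hex
  refine Finset.prod_eq_zero (Finset.mem_univ i) ?_
  rcases hi with ⟨h1, h2⟩ | ⟨h1, h2⟩
  · simp only [rowTerm, h1, h2, dite_true, dite_false, star_one, mul_one]
    exact h.integral_centred i _ _
  · simp only [rowTerm, h1, h2, dite_true, dite_false, one_mul]
    have := integral_conj (μ := P)
      (f := fun ω => centred (q'.1 ⟨i, h2⟩) (q'.1 (q'.2 ⟨i, h2⟩)) (M ω i))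
    rw [h.integral_centred i, map_zero] at this
    exact this

lemma StandardEntries.norm_integral_minorTerm_mul_star_le (h : StandardEntries P M β)
    (S : Finset ι) (q q' : (S ↪ κ) × Perm S) :
    ‖∫ ω, minorTerm S q (M ω) * star (minorTerm S q' (M ω)) ∂P‖ ≤
      ∏ a, covBound (β - 1) (q.1 a) (q.1 (q.2 a)) (q'.1 a) (q'.1 (q'.2 a)) := by
  have hP : IsProbabilityMeasure P := h.indep.isProbabilityMeasure
  rw [h.integral_minorTerm_mul_star, norm_prod, ← prod_dite_mem S
    (fun a => covBound (β - 1) (q.1 a) (q.1 (q.2 a)) (q'.1 a) (q'.1 (q'.2 a)))]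
  refine Finset.prod_le_prod (fun i _ => norm_nonneg _) fun i _ => ?_
  by_cases hi : i ∈ S
  · simp only [rowTerm, hi, dite_true]
    exact h.norm_integral_centred_mul_star_le i _ _ _ _
  · simp [rowTerm, hi]

lemma StandardEntries.integrable_mixedMinor_mul_star (h : StandardEntries P M β)
    (S S' : Finset ι) :
    Integrable (fun ω => mixedMinor (centredRow (M ω)) S *
      star (mixedMinor (centredRow (M ω)) S')) P := by
  simp_rw [mixedMinor_eq_sum_minorTerm, star_sum, Finset.sum_mul_sum]
  refine integrable_finsetSum _ fun q _ => integrable_finsetSum _ fun q' _ => ?_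
  have := (h.integrable_minorTerm_mul_star S S' q q').const_mul
    (((Perm.sign q.2 : ℤ) : ℂ) * star ((Perm.sign q'.2 : ℤ) : ℂ))
  refine this.congr (ae_of_all _ fun ω => ?_)
  simp only [star_mul']
  ring

lemma StandardEntries.integral_mixedMinor_mul_star (h : StandardEntries P M β)
    (S S' : Finset ι) :
    ∫ ω, mixedMinor (centredRow (M ω)) S * star (mixedMinor (centredRow (M ω)) S') ∂P =
      ∑ q : (S ↪ κ) × Perm S, ∑ q' : (S' ↪ κ) × Perm S',
        (((Perm.sign q.2 : ℤ) : ℂ) * star ((Perm.sign q'.2 : ℤ) : ℂ)) *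
          ∫ ω, minorTerm S q (M ω) * star (minorTerm S' q' (M ω)) ∂P := by
  have e : ∀ ω, mixedMinor (centredRow (M ω)) S * star (mixedMinor (centredRow (M ω)) S') =
      ∑ q : (S ↪ κ) × Perm S, ∑ q' : (S' ↪ κ) × Perm S',
        (((Perm.sign q.2 : ℤ) : ℂ) * star ((Perm.sign q'.2 : ℤ) : ℂ)) *
          (minorTerm S q (M ω) * star (minorTerm S' q' (M ω))) := by
    intro ω
    simp_rw [mixedMinor_eq_sum_minorTerm, star_sum, Finset.sum_mul_sum]
    refine Finset.sum_congr rfl fun q _ => Finset.sum_congr rfl fun q' _ => ?_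
    simp only [star_mul']
    ring
  simp_rw [e]
  have hi := fun q q' => (h.integrable_minorTerm_mul_star S S' q q').const_mul
    (((Perm.sign q.2 : ℤ) : ℂ) * star ((Perm.sign q'.2 : ℤ) : ℂ))
  rw [integral_finsetSum _ fun q _ => integrable_finsetSum _ fun q' _ => hi q q']
  refine Finset.sum_congr rfl fun q _ => ?_
  rw [integral_finsetSum _ fun q' _ => hi q q']
  refine Finset.sum_congr rfl fun q' _ => ?_
  rw [integral_const_mul]

lemma StandardEntries.integral_mixedMinor_mul_star_of_ne (h : StandardEntries P M β)
    {S S' : Finset ι} (hS : S ≠ S') :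
    ∫ ω, mixedMinor (centredRow (M ω)) S * star (mixedMinor (centredRow (M ω)) S') ∂P = 0 := by
  rw [h.integral_mixedMinor_mul_star]
  refine Finset.sum_eq_zero fun q _ => Finset.sum_eq_zero fun q' _ => ?_
  rw [h.integral_minorTerm_mul_star_of_ne hS, mul_zero]

lemma StandardEntries.norm_integral_mixedMinor_mul_star_le (h : StandardEntries P M β)
    (hβ : 1 ≤ β) (S : Finset ι) :
    ‖∫ ω, mixedMinor (centredRow (M ω)) S * star (mixedMinor (centredRow (M ω)) S) ∂P‖ ≤
      (Fintype.card κ).descFactorial S.card * ((S.card + 1)! * Real.exp (β - 1)) := by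
  rw [h.integral_mixedMinor_mul_star]
  have hsum := sum_prod_covBound_le (α := S) (κ := κ) (b := β - 1) (by linarith)
  rw [Fintype.card_coe] at hsum
  refine le_trans ?_ hsum
  have e : ∑ q : (S ↪ κ) × Perm S × (S ↪ κ) × Perm S,
      ∏ a, covBound (β - 1) (q.1 a) (q.1 (q.2.1 a)) (q.2.2.1 a) (q.2.2.1 (q.2.2.2 a)) =
      ∑ q : (S ↪ κ) × Perm S, ∑ q' : (S ↪ κ) × Perm S,
        ∏ a, covBound (β - 1) (q.1 a) (q.1 (q.2 a)) (q'.1 a) (q'.1 (q'.2 a)) := by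
    rw [Fintype.sum_prod_type, Fintype.sum_prod_type]
    refine Finset.sum_congr rfl fun σ _ => ?_
    rw [Fintype.sum_prod_type]
  rw [e]
  refine (norm_sum_le _ _).trans (Finset.sum_le_sum fun q _ => ?_)
  refine (norm_sum_le _ _).trans (Finset.sum_le_sum fun r _ => ?_)
  have hs : ∀ ρ : Perm S, ‖((Perm.sign ρ : ℤ) : ℂ)‖ = 1 := by
    intro ρ
    rcases Int.units_eq_one_or (Perm.sign ρ) with h | h <;> simp [h]
  rw [norm_mul, norm_mul, norm_star, hs, hs, one_mul, one_mul]
  exact h.norm_integral_minorTerm_mul_star_le S q r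

/-- The coefficient of `mixedMinor (centredRow N) S` in the characteristic polynomial. -/
noncomputable def minorCoeff (p n : ℕ) (x : ℂ) (m : ℕ) : ℂ :=
  (-1) ^ m * laguerre (p - m) (n - m) x

lemma norm_det_sq_expansion (N : ι → κ → ℂ) (hcard : Fintype.card ι ≤ Fintype.card κ) (x : ℂ) :
    ((‖(Matrix.scalar ι x - Matrix.of N * (Matrix.of N)ᴴ).det‖ ^ 2 : ℝ) : ℂ) =
      ∑ S : Finset ι, ∑ S' : Finset ι,
        (minorCoeff (Fintype.card ι) (Fintype.card κ) x S.card *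
          star (minorCoeff (Fintype.card ι) (Fintype.card κ) x S'.card)) *
        (mixedMinor (centredRow N) S * star (mixedMinor (centredRow N) S')) := by
  rw [← mul_star_eq_norm_sq, det_sub_gram_expansion (Matrix.of N) x hcard,
    star_sum, Finset.sum_mul_sum]
  refine Finset.sum_congr rfl fun S _ => Finset.sum_congr rfl fun S' _ => ?_
  simp only [star_mul', minorCoeff]
  change _ * mixedMinor (centredRow N) S * (_ * star (mixedMinor (centredRow N) S')) = _
  ring

lemma StandardEntries.integrable_norm_det_sq (h : StandardEntries P M β)
    (hcard : Fintype.card ι ≤ Fintype.card κ) (x : ℂ) :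
    Integrable (fun ω => ‖(Matrix.scalar ι x -
      (Matrix.of (M ω)) * (Matrix.of (M ω))ᴴ).det‖ ^ 2) P := by
  have hInt : Integrable (fun ω => ((‖(Matrix.scalar ι x -
      (Matrix.of (M ω)) * (Matrix.of (M ω))ᴴ).det‖ ^ 2 : ℝ) : ℂ)) P := by
    simp_rw [norm_det_sq_expansion _ hcard]
    exact integrable_finsetSum _ fun S _ => integrable_finsetSum _ fun S' _ =>
      (h.integrable_mixedMinor_mul_star S S').const_mul _
  exact hInt.re

lemma StandardEntries.integral_norm_det_sq_le (h : StandardEntries P M β)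
    (hβ : 1 ≤ β) (hcard : Fintype.card ι ≤ Fintype.card κ) (x : ℂ) :
    ∫ ω, ‖(Matrix.scalar ι x - (Matrix.of (M ω)) * (Matrix.of (M ω))ᴴ).det‖ ^ 2 ∂P ≤
      ∑ S : Finset ι,
        ‖laguerre (Fintype.card ι - S.card) (Fintype.card κ - S.card) x‖ ^ 2 *
          ((Fintype.card κ).descFactorial S.card * ((S.card + 1)! * Real.exp (β - 1))) := by
  let c : Finset ι → ℂ := fun S => minorCoeff (Fintype.card ι) (Fintype.card κ) x S.card
  have hi := fun S S' => (h.integrable_mixedMinor_mul_star S S').const_mul (c S * star (c S'))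
  have e2 : ((∫ ω, ‖(Matrix.scalar ι x - (Matrix.of (M ω)) * (Matrix.of (M ω))ᴴ).det‖ ^ 2 ∂P : ℝ) : ℂ)
      = ∑ S, (c S * star (c S)) *
        ∫ ω, mixedMinor (centredRow (M ω)) S * star (mixedMinor (centredRow (M ω)) S) ∂P := by
    rw [← integral_complex_ofReal]
    simp_rw [norm_det_sq_expansion _ hcard]
    rw [integral_finsetSum _ fun S _ => integrable_finsetSum _ fun S' _ => hi S S']
    refine Finset.sum_congr rfl fun S _ => ?_
    rw [integral_finsetSum _ fun S' _ => hi S S', Finset.sum_eq_single S]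
    · rw [integral_const_mul]
    · intro S' _ hne
      rw [integral_const_mul, h.integral_mixedMinor_mul_star_of_ne (Ne.symm hne), mul_zero]
    · simp
  -- A nonnegative real equals the norm of its complex cast, so the triangle inequality applies to
  -- the complex expansion.
  have e3 : ∫ ω, ‖(Matrix.scalar ι x - (Matrix.of (M ω)) * (Matrix.of (M ω))ᴴ).det‖ ^ 2 ∂P =
      ‖((∫ ω, ‖(Matrix.scalar ι x - (Matrix.of (M ω)) * (Matrix.of (M ω))ᴴ).det‖ ^ 2 ∂P : ℝ) : ℂ)‖ := by
    rw [Complex.norm_real, Real.norm_eq_abs, abs_of_nonneg]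
    exact integral_nonneg fun ω => by positivity
  rw [e3, e2]
  refine (norm_sum_le _ _).trans (Finset.sum_le_sum fun S _ => ?_)
  rw [norm_mul]
  have e4 : ‖c S * star (c S)‖ =
      ‖laguerre (Fintype.card ι - S.card) (Fintype.card κ - S.card) x‖ ^ 2 := by
    simp [c, minorCoeff, sq]
  rw [e4]
  gcongr
  exact h.norm_integral_mixedMinor_mul_star_le hβ S

end SecondMoment

/-! ### Pointwise bounds for the Laguerre polynomials by Cauchy's estimate. -/

section Laguerre

open scoped Nat

lemma iteratedDeriv_exp_mul_one_sub_pow (p n : ℕ) (x : ℂ) :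
    iteratedDeriv p (fun t => Complex.exp (x * t) * (1 - t) ^ n) 0 = laguerre p n x := by
  rw [iteratedDeriv_fun_mul (by fun_prop) (by fun_prop), laguerre, ← Finset.sum_range_reflect]
  refine Finset.sum_congr rfl fun k hk => ?_
  have hk' : k ≤ p := by simpa [Nat.lt_succ_iff] using hk
  have e : p + 1 - 1 - k = p - k := by omega
  have h1 := iteratedDeriv_comp_const_sub k (fun t : ℂ => t ^ n) 1
  have h2 : iteratedDeriv k (fun t : ℂ => (1 - t) ^ n) 0 = (-1) ^ k * n.descFactorial k := by
    rw [h1]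
    simp
  rw [e, iteratedDeriv_cexp_const_mul, Nat.sub_sub_self hk', h2, Nat.choose_symm hk']
  simp
  ring

/-- The maximum over `s` is attained at `s = n/x`; the bound is the `n`-th power of `y ≤ e^(y-1)`
with `y = xs/n`. -/
lemma pow_mul_exp_neg_le {n : ℕ} (hn : 1 ≤ n) {x s : ℝ} (hx : 0 < x) (hs : 0 ≤ s) :
    s ^ n * Real.exp (-(x * s)) ≤ (n / x) ^ n * Real.exp (-n) := by
  have hn' : (0 : ℝ) < n := by exact_mod_cast hn
  have h1 : x * s / n ≤ Real.exp (x * s / n - 1) := by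
    have := Real.add_one_le_exp (x * s / n - 1)
    linarith
  have h2 : (x * s / n) ^ n ≤ Real.exp (x * s - n) := by
    calc (x * s / n) ^ n ≤ Real.exp (x * s / n - 1) ^ n := by gcongr
      _ = Real.exp (x * s - n) := by
        rw [← Real.exp_nat_mul]
        congr 1
        field_simp
  have h3 : s ^ n = (n / x) ^ n * (x * s / n) ^ n := by
    rw [← mul_pow]
    congr 1
    field_simp
  rw [h3, mul_assoc]
  gcongr
  calc (x * s / n) ^ n * Real.exp (-(x * s)) ≤ Real.exp (x * s - n) * Real.exp (-(x * s)) := by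
        gcongr
    _ = Real.exp (-n) := by rw [← Real.exp_add]; congr 1; ring

/-- On `|t| = r` one has `|1-t|² = 1 - 2 Re t + r²`, so the squared modulus of `e^(xt) (1-t)ⁿ` is a
function of `|1-t|²` alone, and `pow_mul_exp_neg_le` bounds it. -/
lemma norm_laguerre_sq_le_of_pos {p n : ℕ} (hp : 1 ≤ p) (hn : 1 ≤ n) {x : ℝ} (hx : 0 < x) :
    ‖laguerre p n x‖ ^ 2 ≤
      (p ! : ℝ) ^ 2 * (x / p) ^ p * Real.exp (x + p - n) * (n / x) ^ n := by
  have hp' : (0 : ℝ) < p := by exact_mod_cast hp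
  -- This radius minimises `r^(-2p) e^(x r²)`, the part of the squared Cauchy bound that depends on
  -- `r`.
  set r := √(p / x)
  have hr : 0 < r := Real.sqrt_pos.mpr (by positivity)
  have hr2 : r ^ 2 = p / x := Real.sq_sqrt (by positivity)
  set B := Real.exp (x + p - n) * (n / x) ^ n
  have hB : 0 ≤ B := by positivity
  have hbound : ∀ t ∈ Metric.sphere (0 : ℂ) r,
      ‖Complex.exp (x * t) * (1 - t) ^ n‖ ≤ √B := by
    intro t ht
    have htr : ‖t‖ = r := by simpa using ht
    refine Real.le_sqrt_of_sq_le ?_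
    have hs : ‖1 - t‖ ^ 2 = 1 - 2 * t.re + r ^ 2 := by
      rw [← htr, ← Complex.normSq_eq_norm_sq, ← Complex.normSq_eq_norm_sq, Complex.normSq_apply,
        Complex.normSq_apply]
      simp
      ring
    have e1 : ‖Complex.exp (x * t) * (1 - t) ^ n‖ ^ 2 =
        Real.exp (x + p) * ((‖1 - t‖ ^ 2) ^ n * Real.exp (-(x * ‖1 - t‖ ^ 2))) := by
      rw [norm_mul, norm_pow, Complex.norm_exp, mul_pow, ← pow_mul, ← pow_mul, mul_comm n 2,
        ← Real.exp_nat_mul]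
      have : Real.exp ((2 : ℕ) * (x * t : ℂ).re) =
          Real.exp (x + p) * Real.exp (-(x * ‖1 - t‖ ^ 2)) := by
        rw [← Real.exp_add, hs, hr2]
        congr 1
        simp
        field_simp
        ring
      rw [this]
      ring
    rw [e1]
    calc Real.exp (x + p) * ((‖1 - t‖ ^ 2) ^ n * Real.exp (-(x * ‖1 - t‖ ^ 2)))
        ≤ Real.exp (x + p) * ((n / x) ^ n * Real.exp (-n)) := by
          exact mul_le_mul_of_nonneg_left (pow_mul_exp_neg_le hn hx (by positivity))
            (Real.exp_nonneg _)
      _ = B := by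
          simp only [B]
          rw [sub_eq_add_neg, Real.exp_add (x + p) (-n)]
          ring
  have hc := Complex.norm_iteratedDeriv_le_of_forall_mem_sphere_norm_le (c := 0) p hr
    (f := fun t => Complex.exp (x * t) * (1 - t) ^ n)
    (Differentiable.diffContOnCl (by fun_prop)) hbound
  rw [iteratedDeriv_exp_mul_one_sub_pow] at hc
  calc ‖laguerre p n x‖ ^ 2 ≤ (p ! * √B / r ^ p) ^ 2 := by gcongr
    _ = (p ! : ℝ) ^ 2 * B / (r ^ 2) ^ p := by
        rw [div_pow, mul_pow, Real.sq_sqrt hB, ← pow_mul, ← pow_mul, mul_comm p 2]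
    _ = _ := by
        rw [hr2, div_pow, div_pow]
        simp only [B]
        field_simp

/-- The Stirling sequence decreases from its value `e/√2` at 1. -/
lemma factorial_le_exp_mul_sqrt {p : ℕ} (hp : 1 ≤ p) :
    (p ! : ℝ) ≤ Real.exp 1 * √p * (p / Real.exp 1) ^ p := by
  obtain ⟨q, rfl⟩ : ∃ q, p = q + 1 := ⟨p - 1, by omega⟩
  have h1 : Stirling.stirlingSeq (q + 1) ≤ Stirling.stirlingSeq 1 :=
    Stirling.stirlingSeq'_antitone (Nat.zero_le q)
  rw [Stirling.stirlingSeq_one, Stirling.stirlingSeq, div_le_iff₀ (by positivity)] at h1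
  refine h1.trans (le_of_eq ?_)
  rw [Real.sqrt_mul (by norm_num)]
  field_simp

lemma pow_div_exp_le_factorial (n : ℕ) : ((n : ℝ) / Real.exp 1) ^ n ≤ n ! := by
  have h := Real.pow_div_factorial_le_exp (n : ℝ) (Nat.cast_nonneg n) n
  rw [div_le_iff₀ (by positivity)] at h
  rw [div_pow, div_le_iff₀ (by positivity), ← Real.exp_nat_mul, mul_one]
  linarith

/-- The power of `x` makes the Cauchy bound symmetric in the two factorials. The extra parameter `q`
lets all degrees `p - m` share the factor `√p` later, including degree 0. The optimal circle
degenerates when `p = 0` or `x = 0`, so these cases are computed directly. -/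
lemma norm_laguerre_sq_mul_pow_le {p n q : ℕ} (hpn : p ≤ n) (hpq : p ≤ q) (hq : 1 ≤ q)
    {x : ℝ} (hx : 0 ≤ x) :
    ‖laguerre p n x‖ ^ 2 * x ^ (n - p) ≤ 3 * √q * (p ! * n ! * Real.exp x) := by
  have hq1 : 1 ≤ √(q : ℝ) := Real.one_le_sqrt.mpr (by exact_mod_cast hq)
  have hbig : ∀ y : ℝ, 0 ≤ y → y ≤ 3 * √q * y := by
    intro y hy
    nlinarith
  rcases Nat.eq_zero_or_pos p with rfl | hp
  · have h1 : laguerre 0 n x = 1 := by simp [laguerre]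
    rw [h1]
    have h := Real.pow_div_factorial_le_exp x hx n
    rw [div_le_iff₀ (by positivity)] at h
    refine le_trans ?_ (hbig _ (by positivity))
    simp
    linarith
  rcases hx.eq_or_lt with rfl | hx
  · rcases hpn.eq_or_lt with rfl | hlt
    · have h1 : laguerre p p ((0 : ℝ) : ℂ) = (-1) ^ p * (p ! : ℂ) := by
        rw [laguerre, Finset.sum_eq_single p]
        · simp [Nat.descFactorial_self]
        · intro k hk hkp
          have : p - k ≠ 0 := by simp at hk; omega
          simp [this]
        · simp
      rw [h1]
      refine le_trans (le_of_eq ?_) (hbig _ (by positivity))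
      simp [sq]
    · rw [zero_pow (by omega), mul_zero]
      positivity
  have hn : 1 ≤ n := le_trans (Nat.succ_le_of_lt hp) hpn
  have h1 := norm_laguerre_sq_le_of_pos hp hn hx
  have hp' : (0 : ℝ) < p := by exact_mod_cast hp
  have hn' : (0 : ℝ) < n := by exact_mod_cast hn
  have hxn : x ^ n = x ^ p * x ^ (n - p) := by rw [← pow_add, Nat.add_sub_cancel' hpn]
  have h2 : (p ! : ℝ) ^ 2 * (x / p) ^ p * Real.exp (x + p - n) * (n / x) ^ n * x ^ (n - p) =
      (p ! : ℝ) * Real.exp x * (((n : ℝ) / Real.exp 1) ^ n) *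
        ((p ! : ℝ) / (p / Real.exp 1) ^ p) := by
    rw [sub_eq_add_neg, Real.exp_add, Real.exp_add, Real.exp_neg, div_pow, div_pow, div_pow,
      div_pow, hxn, ← Real.exp_nat_mul, ← Real.exp_nat_mul, mul_one, mul_one]
    field_simp
  have h3 : (p ! : ℝ) / (p / Real.exp 1) ^ p ≤ 3 * √q := by
    rw [div_le_iff₀ (by positivity)]
    refine (factorial_le_exp_mul_sqrt hp).trans ?_
    have : Real.exp 1 ≤ 3 := by linarith [Real.exp_one_lt_d9]
    gcongr
  calc ‖laguerre p n x‖ ^ 2 * x ^ (n - p)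
      ≤ (p ! : ℝ) ^ 2 * (x / p) ^ p * Real.exp (x + p - n) * (n / x) ^ n * x ^ (n - p) := by
        gcongr
    _ = _ := h2
    _ ≤ (p ! : ℝ) * Real.exp x * n ! * (3 * √q) := by
        gcongr
        exact pow_div_exp_le_factorial n
    _ = _ := by ring

end Laguerre

/-! ### Integrals of `log |e^{iθ} - e^{iη}|` against the Poisson kernel and the cosine. -/

section LogIntegrals

open Real Filter Topology

/-- The Poisson kernel of the unit disc at the real point `x`. -/
noncomputable def realPoisson (x θ : ℝ) : ℝ := (1 - x ^ 2) / (1 - 2 * x * cos θ + x ^ 2)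

lemma realPoisson_denom_pos {x : ℝ} (hx : |x| < 1) (θ : ℝ) : 0 < 1 - 2 * x * cos θ + x ^ 2 := by
  have h1 : |x * cos θ| ≤ |x| := by
    rw [abs_mul]
    exact mul_le_of_le_one_right (abs_nonneg x) (abs_cos_le_one θ)
  have h2 := le_abs_self (x * cos θ)
  have h3 : x ^ 2 = |x| ^ 2 := (sq_abs x).symm
  nlinarith [sq_nonneg (1 - |x|)]

lemma continuous_realPoisson {x : ℝ} (hx : |x| < 1) : Continuous (realPoisson x) := by
  unfold realPoisson
  exact continuous_const.div (by fun_prop) fun θ => (realPoisson_denom_pos hx θ).ne'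

lemma norm_sub_circleMap_sq (x θ : ℝ) :
    ‖(x : ℂ) - circleMap 0 1 θ‖ ^ 2 = 1 - 2 * x * cos θ + x ^ 2 := by
  rw [← Complex.normSq_eq_norm_sq, Complex.normSq_apply]
  simp [circleMap, Complex.exp_re, Complex.exp_im]
  nlinarith [sin_sq_add_cos_sq θ]

lemma realPoisson_eq_re_herglotzRieszKernel (x θ : ℝ) :
    realPoisson x θ = (herglotzRieszKernel 0 x (circleMap 0 1 θ)).re := by
  have h := congrFun (poissonKernel_eq_re_herglotzRieszKernel (c := 0) (w := (x : ℂ)))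
    (circleMap 0 1 θ)
  rw [Function.comp_apply] at h
  rw [← h, poissonKernel, sub_zero, sub_zero, norm_sub_rev (circleMap 0 1 θ),
    norm_sub_circleMap_sq]
  simp [realPoisson]

/-- `log |e^{iθ} - e^{iη}|`. -/
noncomputable def logChord (η θ : ℝ) : ℝ := log ‖circleMap 0 1 θ - circleMap 0 1 η‖

lemma intervalIntegrable_logChord (η : ℝ) :
    IntervalIntegrable (logChord η) volume 0 (2 * π) :=
  circleIntegrable_log_norm_sub_const (a := circleMap 0 1 η) (c := 0) 1

lemma integral_logChord (η : ℝ) : ∫ θ in (0)..(2 * π), logChord η θ = 0 := by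
  have h := circleAverage_log_norm_sub_const₁ (a := circleMap 0 1 η) (by simp)
  rw [circleAverage_def, smul_eq_mul] at h
  have : (2 * π)⁻¹ ≠ 0 := by positivity
  exact (mul_eq_zero.mp h).resolve_left this

/-- Poisson's formula for `log |w - ρ|` remains valid when the singularity `ρ` lies on the circle.
-/
lemma integral_realPoisson_mul_logChord {x : ℝ} (hx : |x| < 1) (η : ℝ) :
    ∫ θ in (0)..(2 * π), realPoisson x θ * logChord η θ =
      2 * π * log ‖(x : ℂ) - circleMap 0 1 η‖ := by
  have h := circleAverage_re_herglotzRieszKernel_mul_log (w := (x : ℂ)) (ρ := circleMap 0 1 η)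
    (c := 0) (R := 1) (by simp) (by simpa using hx)
  rw [circleAverage_def, smul_eq_mul, inv_mul_eq_iff_eq_mul₀ (by positivity)] at h
  rw [← h]
  refine intervalIntegral.integral_congr fun θ _ => ?_
  simp [realPoisson_eq_re_herglotzRieszKernel, logChord]

lemma integral_realPoisson {x : ℝ} (hx : |x| < 1) :
    ∫ θ in (0)..(2 * π), realPoisson x θ = 2 * π := by
  have h := DiffContOnCl.circleAverage_re_herglotzRieszKernel_smul (E := ℂ) (f := fun _ => 1)
    (c := 0) (R := 1) (w := (x : ℂ)) diffContOnCl_const (by simpa using hx)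
  rw [circleAverage_def] at h
  have h2 : ∀ θ, ((Complex.re ∘ herglotzRieszKernel 0 (x : ℂ)) • fun _ => (1 : ℂ))
      (circleMap 0 1 θ) = ((realPoisson x θ : ℝ) : ℂ) := by
    intro θ
    rw [realPoisson_eq_re_herglotzRieszKernel]
    simp
  simp_rw [h2] at h
  rw [intervalIntegral.integral_ofReal, Complex.real_smul, ← Complex.ofReal_mul,
    ← Complex.ofReal_one, Complex.ofReal_inj, inv_mul_eq_iff_eq_mul₀ (by positivity)] at h
  rw [h, mul_one]

/-- The Poisson kernel is `1 + 2x cos θ + O(x²)`, so this is half the derivative at `x = 0` of the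
Poisson identity, whose right side has derivative `-2π cos η`. -/
lemma integral_cos_mul_logChord (η : ℝ) :
    ∫ θ in (0)..(2 * π), cos θ * logChord η θ = -π * cos η := by
  -- For `x ≠ 0`, `Q x` is the difference quotient `(realPoisson x - 1) / x`, in a form that also
  -- makes sense at 0.
  let Q : ℝ → ℝ → ℝ := fun x θ => (2 * cos θ - 2 * x) / (1 - 2 * x * cos θ + x ^ 2)
  have hden : ∀ x : ℝ, |x| < 1 / 2 → ∀ θ, 1 / 4 ≤ 1 - 2 * x * cos θ + x ^ 2 := by
    intro x hx θ
    have h1 : |x * cos θ| ≤ |x| := by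
      rw [abs_mul]
      exact mul_le_of_le_one_right (abs_nonneg x) (abs_cos_le_one θ)
    have h2 := le_abs_self (x * cos θ)
    have h3 : x ^ 2 = |x| ^ 2 := (sq_abs x).symm
    nlinarith [sq_nonneg (1 - |x|), abs_nonneg x]
  have hsmall : ∀ᶠ x : ℝ in 𝓝[≠] 0, |x| < 1 / 2 := by
    refine nhdsWithin_le_nhds ?_
    have : Metric.ball (0 : ℝ) (1 / 2) ∈ 𝓝 (0 : ℝ) := Metric.ball_mem_nhds 0 (by norm_num)
    filter_upwards [this] with x hx
    simpa using hx
  have hlim : Tendsto (fun x => ∫ θ in (0)..(2 * π), Q x θ * logChord η θ) (𝓝[≠] 0)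
      (𝓝 (∫ θ in (0)..(2 * π), (2 * cos θ) * logChord η θ)) := by
    -- For `|x| < 1/2` the numerator of `Q` is at most 3 and the denominator at least 1/4, so 16
    -- suffices.
    refine intervalIntegral.tendsto_integral_filter_of_dominated_convergence
      (fun θ => 16 * |logChord η θ|) ?_ ?_ ?_ ?_
    · filter_upwards [hsmall] with x hx
      have hc : Continuous (Q x) :=
        (by fun_prop : Continuous fun θ => 2 * cos θ - 2 * x).div (by fun_prop)
          fun θ => by have := hden x hx θ; linarith
      have h1 : AEStronglyMeasurable (logChord η) (volume.restrict (Set.uIoc 0 (2 * π))) :=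
        (intervalIntegrable_logChord η).aestronglyMeasurable_restrict_uIoc
      exact hc.aestronglyMeasurable.mul h1
    · filter_upwards [hsmall] with x hx
      refine ae_of_all _ fun θ _ => ?_
      rw [norm_mul, norm_eq_abs, norm_eq_abs]
      gcongr
      simp only [Q]
      have hd := hden x hx θ
      rw [abs_div, abs_of_pos (by linarith : 0 < 1 - 2 * x * cos θ + x ^ 2),
        div_le_iff₀ (by linarith)]
      have h1 : |2 * cos θ - 2 * x| ≤ 3 := by
        rw [abs_le] at *
        have h2 := neg_one_le_cos θ
        have h3 := cos_le_one θ
        rw [abs_lt] at hx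
        constructor <;> linarith [hx.1, hx.2]
      linarith
    · exact (intervalIntegrable_logChord η).abs.const_mul 16
    · refine ae_of_all _ fun θ _ => ?_
      refine Tendsto.mul ?_ tendsto_const_nhds
      refine tendsto_nhdsWithin_of_tendsto_nhds ?_
      have hc : ContinuousAt (fun x => Q x θ) 0 := by
        refine ContinuousAt.div (by fun_prop) (by fun_prop) (by simp)
      have := hc.tendsto
      simpa [Q] using this
  have hderiv : HasDerivAt (fun x : ℝ => log ‖(x : ℂ) - circleMap 0 1 η‖) (-cos η) 0 := by
    have e : (fun x : ℝ => log ‖(x : ℂ) - circleMap 0 1 η‖) =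
        fun x => 1 / 2 * log (1 - 2 * x * cos η + x ^ 2) := by
      ext x
      rw [← norm_sub_circleMap_sq, log_pow]
      push_cast
      ring
    rw [e]
    have h1 : HasDerivAt (fun x : ℝ => 1 - 2 * x * cos η + x ^ 2) (-2 * cos η) 0 := by
      have h2 := (((hasDerivAt_id (0 : ℝ)).const_mul 2).mul_const (cos η)).const_sub 1
      have h3 := h2.add (hasDerivAt_pow 2 (0 : ℝ))
      convert! h3 using 1
      simp
    have h4 := (h1.log (by simp)).const_mul (1 / 2)
    convert! h4 using 1
    simp
  have hslope := (hasDerivAt_iff_tendsto_slope.mp hderiv).const_mul (2 * π)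
  have heq : (fun x => 2 * π * slope (fun x : ℝ => log ‖(x : ℂ) - circleMap 0 1 η‖) 0 x)
      =ᶠ[𝓝[≠] 0] fun x => ∫ θ in (0)..(2 * π), Q x θ * logChord η θ := by
    filter_upwards [hsmall, self_mem_nhdsWithin] with x hx hx0
    have hx0' : x ≠ 0 := hx0
    have hx1 : |x| < 1 := by linarith
    have h1 : ∀ θ, Q x θ * logChord η θ =
        x⁻¹ * (realPoisson x θ * logChord η θ - logChord η θ) := by
      intro θ
      have hd : 1 - 2 * x * cos θ + x ^ 2 ≠ 0 := (realPoisson_denom_pos hx1 θ).ne'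
      have hQ : Q x θ = x⁻¹ * (realPoisson x θ - 1) := by
        simp only [Q, realPoisson]
        rw [div_sub_one hd, ← mul_div_assoc]
        congr 1
        field_simp
        ring
      rw [hQ]
      ring
    simp_rw [h1]
    have hInt : IntervalIntegrable (fun θ => realPoisson x θ * logChord η θ) volume 0 (2 * π) :=
      (intervalIntegrable_logChord η).continuousOn_mul (continuous_realPoisson hx1).continuousOn
    rw [intervalIntegral.integral_const_mul,
      intervalIntegral.integral_sub hInt (intervalIntegrable_logChord η), integral_logChord,
      integral_realPoisson_mul_logChord hx1, slope_def_field]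
    simp
    field_simp
  have hfin := tendsto_nhds_unique (hslope.congr' heq) hlim
  have h2 : ∫ θ in (0)..(2 * π), (2 * cos θ) * logChord η θ =
      2 * ∫ θ in (0)..(2 * π), cos θ * logChord η θ := by
    rw [← intervalIntegral.integral_const_mul]
    congr 1
    ext θ
    ring
  rw [h2] at hfin
  linarith

end LogIntegrals

/-! ### Closed form of the Marchenko–Pastur potential on the bulk. -/

section LogPotential

open Real

/-- The function `sin² θ / (1 + s² + 2 s cos θ)`, written through the Poisson kernel. -/
noncomputable def arcWeight (s θ : ℝ) : ℝ :=
  (1 + s ^ 2) / (4 * s ^ 2) - 1 / (2 * s) * cos θ -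
    (1 - s ^ 2) / (4 * s ^ 2) * realPoisson (-s) θ

lemma arcWeight_mul {s θ : ℝ} (hs : 0 < s) (hd : 1 + s ^ 2 + 2 * s * cos θ ≠ 0) :
    arcWeight s θ * (1 + s ^ 2 + 2 * s * cos θ) = sin θ ^ 2 := by
  have h1 : realPoisson (-s) θ * (1 + s ^ 2 + 2 * s * cos θ) = 1 - s ^ 2 := by
    have h2 : 1 - 2 * -s * cos θ + (-s) ^ 2 = 1 + s ^ 2 + 2 * s * cos θ := by ring
    rw [realPoisson, h2, div_mul_cancel₀ _ hd]
    ring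
  rw [arcWeight, sub_mul, mul_assoc ((1 - s ^ 2) / (4 * s ^ 2)), h1, sin_sq]
  field_simp
  ring

/-- At `s = 1` the pole of the kernel reaches the circle, but the coefficient vanishes there;
keeping the product together covers `φ = 1`. -/
lemma continuous_mul_realPoisson {s : ℝ} (hs : 0 < s) (hs1 : s ≤ 1) :
    Continuous fun θ => (1 - s ^ 2) / (4 * s ^ 2) * realPoisson (-s) θ := by
  rcases hs1.lt_or_eq with h | rfl
  · exact continuous_const.mul (continuous_realPoisson (by rw [abs_neg, abs_of_pos hs]; exact h))
  · simpa using continuous_const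

lemma continuous_arcWeight {s : ℝ} (hs : 0 < s) (hs1 : s ≤ 1) : Continuous (arcWeight s) := by
  have h := continuous_mul_realPoisson hs hs1
  unfold arcWeight
  fun_prop

lemma integral_arcWeight {s : ℝ} (hs : 0 < s) (hs1 : s ≤ 1) :
    ∫ θ in (0)..(2 * π), arcWeight s θ = π := by
  have h := continuous_mul_realPoisson hs hs1
  have h1 : ∫ θ in (0)..(2 * π), (1 - s ^ 2) / (4 * s ^ 2) * realPoisson (-s) θ =
      (1 - s ^ 2) / (4 * s ^ 2) * (2 * π) := by
    rcases hs1.lt_or_eq with h | rfl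
    · rw [intervalIntegral.integral_const_mul,
        integral_realPoisson (by rw [abs_neg, abs_of_pos hs]; exact h)]
    · simp
  simp only [arcWeight]
  rw [intervalIntegral.integral_sub (Continuous.intervalIntegrable (by fun_prop) _ _)
    (h.intervalIntegrable _ _), h1,
    intervalIntegral.integral_sub (Continuous.intervalIntegrable (by fun_prop) _ _)
    (Continuous.intervalIntegrable (by fun_prop) _ _), intervalIntegral.integral_const_mul,
    integral_cos]
  simp
  field_simp
  ring

lemma intervalIntegrable_arcWeight_mul_logChord {s : ℝ} (hs : 0 < s) (hs1 : s ≤ 1) (η : ℝ) :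
    IntervalIntegrable (fun θ => arcWeight s θ * logChord η θ) volume 0 (2 * π) :=
  (intervalIntegrable_logChord η).continuousOn_mul (continuous_arcWeight hs hs1).continuousOn

lemma integral_arcWeight_mul_logChord {s : ℝ} (hs : 0 < s) (hs1 : s ≤ 1) (η : ℝ) :
    ∫ θ in (0)..(2 * π), arcWeight s θ * logChord η θ =
      π * cos η / (2 * s) -
        (1 - s ^ 2) / (4 * s ^ 2) * (π * log (1 + s ^ 2 + 2 * s * cos η)) := by
  have h := continuous_mul_realPoisson hs hs1
  have hInt : ∀ f : ℝ → ℝ, Continuous f →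
      IntervalIntegrable (fun θ => f θ * logChord η θ) volume 0 (2 * π) := fun f hf =>
    (intervalIntegrable_logChord η).continuousOn_mul hf.continuousOn
  have h1 : ∫ θ in (0)..(2 * π), (1 - s ^ 2) / (4 * s ^ 2) * realPoisson (-s) θ * logChord η θ =
      (1 - s ^ 2) / (4 * s ^ 2) * (π * log (1 + s ^ 2 + 2 * s * cos η)) := by
    rcases hs1.lt_or_eq with h | rfl
    · simp_rw [mul_assoc ((1 - s ^ 2) / (4 * s ^ 2))]
      rw [intervalIntegral.integral_const_mul,
        integral_realPoisson_mul_logChord (by rw [abs_neg, abs_of_pos hs]; exact h)]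
      have h2 := norm_sub_circleMap_sq (-s) η
      have h3 : 1 - 2 * -s * cos η + (-s) ^ 2 = 1 + s ^ 2 + 2 * s * cos η := by ring
      rw [h3] at h2
      rw [← h2, log_pow]
      push_cast
      ring
    · simp
  have h2 : ∀ θ, arcWeight s θ * logChord η θ =
      (1 + s ^ 2) / (4 * s ^ 2) * logChord η θ - 1 / (2 * s) * (cos θ * logChord η θ) -
        (1 - s ^ 2) / (4 * s ^ 2) * realPoisson (-s) θ * logChord η θ := by
    intro θ
    rw [arcWeight]
    ring
  simp_rw [h2]
  rw [intervalIntegral.integral_sub _ (hInt _ h), h1, intervalIntegral.integral_sub,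
    intervalIntegral.integral_const_mul, intervalIntegral.integral_const_mul, integral_logChord,
    integral_cos_mul_logChord]
  · field_simp
    ring
  · exact hInt _ continuous_const
  · exact (hInt _ continuous_cos).const_mul _
  · exact (hInt _ continuous_const).sub ((hInt _ continuous_cos).const_mul _)

/-- This splits the logarithm of a difference of cosines into two chord logarithms, for `η` and
`-η`. -/
lemma norm_circleMap_sub_mul_norm (θ η : ℝ) :
    ‖circleMap 0 1 θ - circleMap 0 1 η‖ * ‖circleMap 0 1 θ - circleMap 0 1 (-η)‖ =
      2 * |cos θ - cos η| := by
  have h : 0 ≤ 2 * |cos θ - cos η| := by positivity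
  rw [← sq_eq_sq₀ (by positivity) h, mul_pow, mul_pow, sq_abs, ← Complex.normSq_eq_norm_sq,
    ← Complex.normSq_eq_norm_sq, Complex.normSq_apply, Complex.normSq_apply]
  simp [circleMap, Complex.exp_re, Complex.exp_im]
  have e1 : (cos θ - cos η) * (cos θ - cos η) + (sin θ - sin η) * (sin θ - sin η) =
      2 - 2 * (cos θ * cos η) - 2 * (sin θ * sin η) := by
    linear_combination sin_sq_add_cos_sq θ + sin_sq_add_cos_sq η
  have e2 : (cos θ - cos η) * (cos θ - cos η) + (sin θ + sin η) * (sin θ + sin η) =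
      2 - 2 * (cos θ * cos η) + 2 * (sin θ * sin η) := by
    linear_combination sin_sq_add_cos_sq θ + sin_sq_add_cos_sq η
  rw [e1, e2]
  have hθ : sin θ ^ 2 = 1 - cos θ ^ 2 := sin_sq θ
  have hη : sin η ^ 2 = 1 - cos η ^ 2 := sin_sq η
  have e3 : (2 - 2 * (cos θ * cos η) - 2 * (sin θ * sin η)) *
      (2 - 2 * (cos θ * cos η) + 2 * (sin θ * sin η)) =
      (2 - 2 * (cos θ * cos η)) ^ 2 - 4 * (sin θ ^ 2 * sin η ^ 2) := by ring
  rw [e3, hθ, hη]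
  ring

lemma log_abs_eq_logChord_add {s θ η : ℝ} (hs : 0 < s) (h : cos θ ≠ cos η) :
    log |2 * s * cos η - 2 * s * cos θ| = log s + (logChord η θ + logChord (-η) θ) := by
  have hprod := norm_circleMap_sub_mul_norm θ η
  have hpos : 0 < 2 * |cos θ - cos η| := by
    have := abs_pos.mpr (sub_ne_zero.mpr h)
    positivity
  have hne := (hprod.symm ▸ hpos).ne'
  have h1 : |2 * s * cos η - 2 * s * cos θ| = s * (2 * |cos θ - cos η|) := by
    rw [← mul_sub, abs_mul, abs_of_pos (by positivity : 0 < 2 * s), abs_sub_comm]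
    ring
  rw [h1, log_mul hs.ne' hpos.ne', ← hprod,
    log_mul (left_ne_zero_of_mul hne) (right_ne_zero_of_mul hne), logChord, logChord]

/-- The integrand of the potential in the angular variable. -/
noncomputable def arcPotential (s η θ : ℝ) : ℝ :=
  arcWeight s θ * log |2 * s * cos η - 2 * s * cos θ|

lemma arcPotential_ae_eq {s : ℝ} (hs : 0 < s) (η : ℝ) :
    arcPotential s η =ᵐ[volume] fun θ =>
      log s * arcWeight s θ + (arcWeight s θ * logChord η θ + arcWeight s θ * logChord (-η) θ) := by
  -- Only angles with `cos θ = cos η`, where the logarithm is singular, have to be excluded; they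
  -- are countable.
  have hc : (circleMap 0 1 ⁻¹' {circleMap 0 1 η, circleMap 0 1 (-η)}).Countable :=
    (Set.toFinite {circleMap 0 1 η, circleMap 0 1 (-η)}).countable.preimage_circleMap 0 one_ne_zero
  filter_upwards [hc.ae_notMem volume] with θ hθ
  have hne : cos θ ≠ cos η := by
    intro h
    have h1 := norm_circleMap_sub_mul_norm θ η
    rw [h, sub_self, abs_zero, mul_zero, mul_eq_zero, norm_eq_zero, norm_eq_zero, sub_eq_zero,
      sub_eq_zero] at h1
    exact hθ (by simpa using h1)
  rw [arcPotential, log_abs_eq_logChord_add hs hne]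
  ring

lemma intervalIntegrable_arcPotential {s : ℝ} (hs : 0 < s) (hs1 : s ≤ 1) (η : ℝ) :
    IntervalIntegrable (arcPotential s η) volume 0 (2 * π) := by
  refine IntervalIntegrable.congr_ae ?_ (ae_restrict_of_ae (arcPotential_ae_eq hs η).symm)
  exact (((continuous_arcWeight hs hs1).intervalIntegrable _ _).const_mul _).add
    ((intervalIntegrable_arcWeight_mul_logChord hs hs1 η).add
      (intervalIntegrable_arcWeight_mul_logChord hs hs1 (-η)))

lemma integral_arcPotential {s : ℝ} (hs : 0 < s) (hs1 : s ≤ 1) (η : ℝ) :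
    ∫ θ in (0)..(2 * π), arcPotential s η θ =
      π * log s + π * cos η / s -
        (1 - s ^ 2) / (2 * s ^ 2) * (π * log (1 + s ^ 2 + 2 * s * cos η)) := by
  have h1 := intervalIntegrable_arcWeight_mul_logChord hs hs1 η
  have h2 := intervalIntegrable_arcWeight_mul_logChord hs hs1 (-η)
  rw [intervalIntegral.integral_congr_ae_restrict
      (ae_restrict_of_ae (arcPotential_ae_eq hs η)),
    intervalIntegral.integral_add
      (((continuous_arcWeight hs hs1).intervalIntegrable _ _).const_mul _) (h1.add h2),
    intervalIntegral.integral_add h1 h2, intervalIntegral.integral_const_mul,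
    integral_arcWeight hs hs1, integral_arcWeight_mul_logChord hs hs1,
    integral_arcWeight_mul_logChord hs hs1, cos_neg]
  field_simp
  ring

/-- The substitution for `t` is injective only on `(0, π)`, and symmetry under `θ ↦ 2π - θ` gives
half of the full integral. -/
lemma integral_arcPotential_half {s : ℝ} (hs : 0 < s) (hs1 : s ≤ 1) (η : ℝ) :
    ∫ θ in Set.Ioo 0 π, arcPotential s η θ =
      (π * log s + π * cos η / s -
        (1 - s ^ 2) / (2 * s ^ 2) * (π * log (1 + s ^ 2 + 2 * s * cos η))) / 2 := by
  have hInt := intervalIntegrable_arcPotential hs hs1 η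
  have hpi := pi_pos
  have h1 : IntervalIntegrable (arcPotential s η) volume 0 π :=
    hInt.mono_set (Set.uIcc_subset_uIcc_left (by
      rw [Set.mem_uIcc]; left; constructor <;> linarith))
  have h2 : IntervalIntegrable (arcPotential s η) volume π (2 * π) :=
    hInt.mono_set (Set.uIcc_subset_uIcc_right (by
      rw [Set.mem_uIcc]; left; constructor <;> linarith))
  have hsymm : ∀ θ, arcPotential s η (2 * π - θ) = arcPotential s η θ := by
    intro θ
    simp [arcPotential, arcWeight, realPoisson, cos_two_pi_sub]
  have h3 : ∫ θ in π..(2 * π), arcPotential s η θ = ∫ θ in (0)..π, arcPotential s η θ := by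
    have := intervalIntegral.integral_comp_sub_left (a := 0) (b := π) (arcPotential s η) (2 * π)
    simp_rw [hsymm] at this
    rw [this]
    congr 1 <;> ring
  have h4 := intervalIntegral.integral_add_adjacent_intervals h1 h2
  rw [h3, integral_arcPotential hs hs1] at h4
  rw [← integral_Ioc_eq_integral_Ioo, ← intervalIntegral.integral_of_le hpi.le]
  linarith

lemma image_cos_Ioo (s : ℝ) (hs : 0 < s) :
    (fun θ => 1 + s ^ 2 + 2 * s * cos θ) '' Set.Ioo 0 π =
      Set.Ioo ((1 - s) ^ 2) ((1 + s) ^ 2) := by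
  ext t
  constructor
  · rintro ⟨θ, ⟨h0, h1⟩, rfl⟩
    have hlt : cos θ < 1 := by
      have := cos_lt_cos_of_nonneg_of_le_pi le_rfl h1.le h0
      rwa [cos_zero] at this
    have hgt : -1 < cos θ := by
      have := cos_lt_cos_of_nonneg_of_le_pi h0.le le_rfl h1
      rwa [cos_pi] at this
    constructor <;> simp only <;> nlinarith
  · rintro ⟨h0, h1⟩
    have hc0 : -1 < (t - 1 - s ^ 2) / (2 * s) := by
      rw [lt_div_iff₀ (by positivity)]
      nlinarith
    have hc1 : (t - 1 - s ^ 2) / (2 * s) < 1 := by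
      rw [div_lt_iff₀ (by positivity)]
      nlinarith
    refine ⟨arccos ((t - 1 - s ^ 2) / (2 * s)), ⟨arccos_pos.mpr hc1, ?_⟩, ?_⟩
    · refine lt_of_le_of_ne (arccos_le_pi _) fun h => ?_
      rw [arccos_eq_pi] at h
      linarith
    · simp only
      rw [cos_arccos hc0.le hc1.le]
      field_simp
      ring

/-- Under the substitution `(t-a)(b-t)` is the perfect square `(2s sin θ)²`, so Jacobian and square
root combine into `sin² θ / t`. -/
lemma density_comp {s θ : ℝ} (hs : 0 < s) (hθ : θ ∈ Set.Ioo 0 π) :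
    |-(2 * s * sin θ)| * density (s ^ 2) (1 + s ^ 2 + 2 * s * cos θ) =
      2 * s ^ 2 / π * arcWeight s θ := by
  have hsin : 0 < sin θ := sin_pos_of_mem_Ioo hθ
  have hmem : 1 + s ^ 2 + 2 * s * cos θ ∈ Set.Ioo ((1 - s) ^ 2) ((1 + s) ^ 2) := by
    rw [← image_cos_Ioo s hs]
    exact ⟨θ, hθ, rfl⟩
  have hd : 0 < 1 + s ^ 2 + 2 * s * cos θ := (sq_nonneg (1 - s)).trans_lt hmem.1
  have hw := arcWeight_mul hs hd.ne'
  have hsq : (1 + s ^ 2 + 2 * s * cos θ - (1 - s) ^ 2) *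
      ((1 + s) ^ 2 - (1 + s ^ 2 + 2 * s * cos θ)) = (2 * s * sin θ) ^ 2 := by
    rw [mul_pow, sin_sq]
    ring
  rw [density, lower, upper, sqrt_sq hs.le, hsq, max_eq_left (sq_nonneg _),
    sqrt_sq (by positivity), abs_neg, abs_of_pos (by positivity), eq_div_of_mul_eq hd.ne' hw]
  field_simp

lemma density_eq_zero {s t : ℝ} (hs : 0 < s) (ht : t ∉ Set.Ioo ((1 - s) ^ 2) ((1 + s) ^ 2)) :
    density (s ^ 2) t = 0 := by
  have : (t - (1 - s) ^ 2) * ((1 + s) ^ 2 - t) ≤ 0 := by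
    by_contra! h
    rw [Set.mem_Ioo, not_and_or, not_lt, not_lt] at ht
    rcases ht with ht | ht <;> nlinarith
  rw [density, lower, upper, sqrt_sq hs.le, max_eq_right this, sqrt_zero, mul_zero]

lemma density_nonneg (s t : ℝ) (hs : 0 < s) : 0 ≤ density (s ^ 2) t := by
  by_cases ht : t ∈ Set.Ioo ((1 - s) ^ 2) ((1 + s) ^ 2)
  · have : 0 < t := (sq_nonneg (1 - s)).trans_lt ht.1
    unfold density
    positivity
  · rw [density_eq_zero hs ht]

lemma measurable_density (φ : ℝ) : Measurable (density φ) := by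
  unfold density
  fun_prop

lemma density_mul_log {s η : ℝ} (hs : 0 < s) (hs1 : s ≤ 1) :
    Integrable (fun t => density (s ^ 2) t * log |1 + s ^ 2 + 2 * s * cos η - t|) ∧
    ∫ t, density (s ^ 2) t * log |1 + s ^ 2 + 2 * s * cos η - t| =
      s ^ 2 * log s + s * cos η - (1 - s ^ 2) / 2 * log (1 + s ^ 2 + 2 * s * cos η) := by
  set g : ℝ → ℝ := fun t => density (s ^ 2) t * log |1 + s ^ 2 + 2 * s * cos η - t| with hg
  have hderiv : ∀ θ ∈ Set.Ioo 0 π, HasDerivWithinAt (fun θ => 1 + s ^ 2 + 2 * s * cos θ)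
      (-(2 * s * sin θ)) (Set.Ioo 0 π) θ := by
    intro θ _
    have := ((hasDerivAt_cos θ).const_mul (2 * s)).const_add (1 + s ^ 2)
    rw [mul_neg] at this
    exact this.hasDerivWithinAt
  have hinj : Set.InjOn (fun θ => 1 + s ^ 2 + 2 * s * cos θ) (Set.Ioo 0 π) := by
    intro θ hθ θ' hθ' h
    have h1 : 2 * s * cos θ = 2 * s * cos θ' := add_left_cancel h
    exact injOn_cos (Set.Ioo_subset_Icc_self hθ) (Set.Ioo_subset_Icc_self hθ')
      (mul_left_cancel₀ (by positivity) h1)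
  have hcomp : ∀ θ ∈ Set.Ioo 0 π, |-(2 * s * sin θ)| • g (1 + s ^ 2 + 2 * s * cos θ) =
      2 * s ^ 2 / π * arcPotential s η θ := by
    intro θ hθ
    have e : 1 + s ^ 2 + 2 * s * cos η - (1 + s ^ 2 + 2 * s * cos θ) =
        2 * s * cos η - 2 * s * cos θ := by ring
    rw [smul_eq_mul, hg]
    simp only
    rw [← mul_assoc, density_comp hs hθ, e, arcPotential, mul_assoc]
  have hsupp : Function.support g ⊆ Set.Ioo ((1 - s) ^ 2) ((1 + s) ^ 2) := by
    intro t ht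
    by_contra h
    exact ht (by simp [hg, density_eq_zero hs h])
  have hpi := pi_pos
  have hI : IntegrableOn (arcPotential s η) (Set.Ioo 0 π) := by
    have h1 := (intervalIntegrable_arcPotential hs hs1 η).1
    exact h1.mono_set fun θ hθ => ⟨hθ.1, by linarith [hθ.2]⟩
  constructor
  · rw [← integrableOn_iff_integrable_of_support_subset hsupp, ← image_cos_Ioo s hs,
      integrableOn_image_iff_integrableOn_abs_deriv_smul measurableSet_Ioo hderiv hinj]
    exact IntegrableOn.congr_fun (hI.const_mul (2 * s ^ 2 / π)) (fun θ hθ => (hcomp θ hθ).symm)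
      measurableSet_Ioo
  · rw [← setIntegral_eq_integral_of_forall_compl_eq_zero (s := Set.Ioo ((1 - s) ^ 2) ((1 + s) ^ 2))
      (fun t ht => by simp [density_eq_zero hs ht]), ← image_cos_Ioo s hs,
      integral_image_eq_integral_abs_deriv_smul measurableSet_Ioo hderiv hinj,
      setIntegral_congr_fun measurableSet_Ioo hcomp, integral_const_mul,
      integral_arcPotential_half hs hs1]
    field_simp

/-- The logarithmic potential of the Marchenko–Pastur law on its bulk. -/
theorem logPotential_law {φ z : ℝ} (hφ : 0 < φ) (hφ1 : φ ≤ 1)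
    (hz : z ∈ Set.Icc (lower φ) (upper φ)) :
    logPotential (law φ) z = (z + (1 - φ) * log z + φ * log φ - 1 - φ) / 2 := by
  obtain ⟨s, hs, rfl⟩ : ∃ s, 0 < s ∧ s ^ 2 = φ := ⟨√φ, sqrt_pos.mpr hφ, sq_sqrt hφ.le⟩
  have hs1 : s ≤ 1 := by nlinarith
  rw [lower, upper, sqrt_sq hs.le] at hz
  obtain ⟨η, hη⟩ : ∃ η, 1 + s ^ 2 + 2 * s * cos η = z := by
    refine ⟨arccos ((z - 1 - s ^ 2) / (2 * s)), ?_⟩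
    rw [cos_arccos]
    · field_simp
      ring
    · rw [le_div_iff₀ (by positivity)]
      nlinarith [hz.1]
    · rw [div_le_iff₀ (by positivity)]
      nlinarith [hz.2]
  have hz0 : 0 ≤ z := (sq_nonneg _).trans hz.1
  obtain ⟨hInt, hval⟩ := density_mul_log (η := η) hs hs1
  rw [hη] at hInt hval
  have hm : Measurable fun t => ENNReal.ofReal (density (s ^ 2) t) :=
    (measurable_density _).ennreal_ofReal
  have hlt : ∀ᵐ t : ℝ, ENNReal.ofReal (density (s ^ 2) t) < ⊤ :=
    ae_of_all _ fun _ => ENNReal.ofReal_lt_top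
  have hnorm : ∀ t : ℝ, ‖(z : ℂ) - t‖ = |z - t| := fun t => by
    rw [← Complex.ofReal_sub, Complex.norm_real, norm_eq_abs]
  have hsm : ∀ t, (ENNReal.ofReal (density (s ^ 2) t)).toReal • log ‖(z : ℂ) - t‖ =
      density (s ^ 2) t * log |z - t| := fun t => by
    rw [ENNReal.toReal_ofReal (density_nonneg s t hs), hnorm, smul_eq_mul]
  rw [logPotential, law, integral_add_measure, integral_smul_measure, integral_dirac,
    integral_withDensity_eq_integral_toReal_smul hm hlt]
  · simp_rw [hsm]
    rw [hval, ENNReal.toReal_ofReal (by linarith), hnorm, sub_zero, abs_of_nonneg hz0, log_pow,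
      smul_eq_mul]
    push_cast
    -- Here `s cos η` is replaced by `(z - 1 - s²) / 2`.
    linear_combination hη / 2
  · exact (integrable_dirac (by simp)).smul_measure ENNReal.ofReal_ne_top
  · rw [integrable_withDensity_iff_integrable_smul' hm hlt]
    simp_rw [hsm]
    exact hInt

end LogPotential

/-! ### Summation over `S` and comparison with the potential. -/

section Conclusion

open scoped Nat

/-- The characteristic polynomials of `M* M` and `M M*` differ by the factor `X^(n-p)`. -/
lemma det_smul_one_sub_covMatrix {p n : ℕ} (hpn : p ≤ n) (hn : 1 ≤ n)
    (M : Matrix (Fin p) (Fin n) ℂ) (z : ℂ) :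
    (z • (1 : Matrix (Fin n) (Fin n) ℂ) - (n : ℂ)⁻¹ • covMatrix M).det =
      ((n : ℂ)⁻¹) ^ n * ((n * z) ^ (n - p) * (Matrix.scalar (Fin p) (n * z) - M * Mᴴ).det) := by
  have hn0 : (n : ℂ) ≠ 0 := by exact_mod_cast (by omega : n ≠ 0)
  have h1 : z • (1 : Matrix (Fin n) (Fin n) ℂ) - (n : ℂ)⁻¹ • covMatrix M =
      (n : ℂ)⁻¹ • (Matrix.scalar (Fin n) (n * z) - Mᴴ * M) := by
    rw [smul_sub, covMatrix, Matrix.scalar_apply, ← Matrix.smul_one_eq_diagonal, smul_smul,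
      inv_mul_cancel_left₀ hn0]
  rw [h1, Matrix.det_smul, Fintype.card_fin, ← Matrix.eval_charpoly,
    Matrix.charpoly_mul_comm_of_le _ _ (by simpa using hpn), Polynomial.eval_mul,
    Polynomial.eval_pow, Polynomial.eval_X, Matrix.eval_charpoly, Fintype.card_fin,
    Fintype.card_fin]

/-- This is the cancellation that leaves each level `m` with only the factor `m + 1` relative to `p!
n!`. -/
lemma choose_mul_descFactorial_mul_factorial {p n : ℕ} (hpn : p ≤ n) {m : ℕ} (hm : m ≤ p) :
    p.choose m * (n.descFactorial m * (m + 1)! * ((p - m)! * (n - m)!)) = (m + 1) * (p ! * n !) := by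
  rw [← Nat.choose_mul_factorial_mul_factorial hm, ← Nat.factorial_mul_descFactorial (hm.trans hpn),
    Nat.factorial_succ]
  ring

/-- The weighted sum of squared Laguerre polynomials bounding the second moment. -/
lemma sum_norm_laguerre_sq_mul_le {p n : ℕ} (hp : 1 ≤ p) (hpn : p ≤ n) {x : ℝ} (hx : 0 ≤ x) :
    x ^ (n - p) * ∑ S : Finset (Fin p), ‖laguerre (p - S.card) (n - S.card) x‖ ^ 2 *
        ((n.descFactorial S.card : ℝ) * (S.card + 1)!) ≤
      12 * p ^ 2 * √p * (p ! * n ! * Real.exp x) := by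
  have hS : ∀ S : Finset (Fin p), S.card ≤ p := fun S => by
    simpa using S.card_le_univ
  calc x ^ (n - p) * ∑ S : Finset (Fin p), ‖laguerre (p - S.card) (n - S.card) x‖ ^ 2 *
        ((n.descFactorial S.card : ℝ) * (S.card + 1)!)
      ≤ ∑ S : Finset (Fin p), 3 * √p * Real.exp x *
        ((n.descFactorial S.card : ℝ) * (S.card + 1)! * ((p - S.card)! * (n - S.card)!)) := by
        rw [Finset.mul_sum]
        refine Finset.sum_le_sum fun S _ => ?_
        have h1 := norm_laguerre_sq_mul_pow_le (p := p - S.card) (n := n - S.card) (q := p)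
          (by omega) (by omega) hp hx
        rw [show n - S.card - (p - S.card) = n - p by have := hS S; omega] at h1
        have h2 := mul_le_mul_of_nonneg_right h1
          (by positivity : 0 ≤ (n.descFactorial S.card : ℝ) * (S.card + 1)!)
        calc _ = _ := by ring
          _ ≤ _ := h2
          _ = _ := by ring
    _ = ∑ m ∈ Finset.range (p + 1), 3 * √p * Real.exp x * ((m + 1) * (p ! * n !)) := by
        rw [← Finset.powerset_univ, Finset.sum_powerset_apply_card (fun m => 3 * √p * Real.exp x *
          ((n.descFactorial m : ℝ) * (m + 1)! * ((p - m)! * (n - m)!)))]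
        rw [Finset.card_univ, Fintype.card_fin]
        refine Finset.sum_congr rfl fun m hm => ?_
        have h1 := choose_mul_descFactorial_mul_factorial hpn (Nat.lt_succ_iff.mp (Finset.mem_range.mp hm))
        have h2 : (p.choose m : ℝ) * (n.descFactorial m * (m + 1)! * ((p - m)! * (n - m)!)) =
          (m + 1) * (p ! * n !) := by exact_mod_cast h1
        rw [nsmul_eq_mul, ← h2]
        ring
    -- Both `m + 1` and the number `p + 1` of levels are at most `2p`, whence `12 = 3 · 2 · 2`.
    _ ≤ ∑ m ∈ Finset.range (p + 1), 3 * √p * Real.exp x * ((2 * p) * (p ! * n !)) := by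
        refine Finset.sum_le_sum fun m hm => ?_
        have h1 : m + 1 ≤ 2 * p := by
          have := Finset.mem_range.mp hm
          omega
        have h2 : (m + 1 : ℝ) ≤ 2 * p := by exact_mod_cast h1
        gcongr
    _ ≤ 12 * p ^ 2 * √p * (p ! * n ! * Real.exp x) := by
        rw [Finset.sum_const, Finset.card_range, nsmul_eq_mul]
        have h2 : ((p + 1 : ℕ) : ℝ) ≤ 2 * p := by exact_mod_cast (by omega : p + 1 ≤ 2 * p)
        refine (mul_le_mul_of_nonneg_right h2 (by positivity)).trans_eq ?_
        ring

lemma exp_two_mul_logPotential {p n : ℕ} (hp : 1 ≤ p) (hpn : p ≤ n) {z : ℝ}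
    (hz : z ∈ Set.Icc (lower (p / n)) (upper (p / n))) :
    Real.exp (2 * n * logPotential (law (p / n)) z) =
      z ^ (n - p) * (p / n) ^ p * Real.exp (n * z) * (Real.exp 1)⁻¹ ^ n *
        (Real.exp 1)⁻¹ ^ p := by
  have hp0 : (0 : ℝ) < p := by exact_mod_cast hp
  have hn0 : (0 : ℝ) < n := by exact_mod_cast hp.trans hpn
  have hφ : (0 : ℝ) < p / n := by positivity
  have hφ1 : (p / n : ℝ) ≤ 1 := by
    rw [div_le_one hn0]
    exact_mod_cast hpn
  -- The point `z = 0` lies in the bulk only for `p = n`, where the exponent is zero; otherwise the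
  -- left endpoint is positive.
  have hzpow : Real.exp ((n - p : ℕ) * Real.log z) = z ^ (n - p) := by
    rcases hpn.eq_or_lt with rfl | hlt
    · simp
    · have hzpos : 0 < z := by
        refine lt_of_lt_of_le ?_ hz.1
        have h1 : √(p / n : ℝ) < 1 := by
          rw [Real.sqrt_lt' one_pos, one_pow, div_lt_one hn0]
          exact_mod_cast hlt
        exact pow_pos (sub_pos.mpr h1) 2
      rw [Real.exp_nat_mul, Real.exp_log hzpos]
  have hppow : Real.exp (p * Real.log (p / n)) = (p / n : ℝ) ^ p := by
    rw [Real.exp_nat_mul, Real.exp_log hφ]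
  rw [logPotential_law hφ hφ1 hz, ← hzpow, ← hppow, ← Real.exp_neg, ← Real.exp_nat_mul,
    ← Real.exp_nat_mul, ← Real.exp_add, ← Real.exp_add, ← Real.exp_add, ← Real.exp_add,
    Nat.cast_sub hpn]
  congr 1
  field_simp
  ring

/-- The elementary bound behind the comparison of the second moment with the potential. -/
lemma factorial_bound_le_exp_logPotential {p n : ℕ} (hp : 1 ≤ p) (hpn : p ≤ n) {z : ℝ}
    (hz : z ∈ Set.Icc (lower (p / n)) (upper (p / n))) :
    (n : ℝ)⁻¹ ^ (2 * n) * (n * z) ^ (n - p) *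
        (12 * p ^ 2 * √p * (p ! * n ! * Real.exp (n * z))) ≤
      12 * Real.exp 1 ^ 2 * p ^ 3 * √n * Real.exp (2 * n * logPotential (law (p / n)) z) := by
  have hp0 : (0 : ℝ) < p := by exact_mod_cast hp
  have hn0 : (0 : ℝ) < n := by exact_mod_cast hp.trans hpn
  have hz0 : 0 ≤ z := (sq_nonneg _).trans hz.1
  have h1 := factorial_le_exp_mul_sqrt hp
  have h2 := factorial_le_exp_mul_sqrt (hp.trans hpn)
  have hsq : √(p : ℝ) * √p = p := Real.mul_self_sqrt hp0.le
  obtain ⟨k, rfl⟩ := Nat.exists_eq_add_of_le hpn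
  rw [exp_two_mul_logPotential hp hpn hz, Nat.add_sub_cancel_left] at *
  calc _ ≤ ((p + k : ℕ) : ℝ)⁻¹ ^ (2 * (p + k)) * ((p + k : ℕ) * z) ^ k *
        (12 * p ^ 2 * √p * ((Real.exp 1 * √p * (p / Real.exp 1) ^ p) *
          (Real.exp 1 * √(p + k : ℕ) * ((p + k : ℕ) / Real.exp 1) ^ (p + k)) *
            Real.exp ((p + k : ℕ) * z))) := by gcongr
    _ = 12 * Real.exp 1 ^ 2 * p ^ 2 * (√p * √p) * √(p + k : ℕ) * (z ^ k *
          (((p + k : ℕ) : ℝ)⁻¹ ^ (2 * (p + k)) * ((p + k : ℕ) : ℝ) ^ k *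
            ((p + k : ℕ) : ℝ) ^ (p + k)) * p ^ p *
            Real.exp ((p + k : ℕ) * z) * (Real.exp 1)⁻¹ ^ (p + k) * (Real.exp 1)⁻¹ ^ p) := by
        rw [div_pow, div_pow, mul_pow, inv_pow (Real.exp 1), inv_pow (Real.exp 1)]
        ring
    _ = _ := by
        -- With `n = p + k` the powers of `n` leave `n^(-p)`, which joins `p^p` to form the factor
        -- `φ^p` of `e^(2nu)`.
        have h3 : ((p + k : ℕ) : ℝ)⁻¹ ^ (2 * (p + k)) * ((p + k : ℕ) : ℝ) ^ k *
            ((p + k : ℕ) : ℝ) ^ (p + k) = (((p + k : ℕ) : ℝ) ^ p)⁻¹ := by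
          generalize ((p + k : ℕ) : ℝ) = N at hn0
          have hN := hn0.ne'
          rw [inv_pow]
          field_simp
          ring
        rw [h3, hsq, div_pow]
        ring

end Conclusion

end MarchenkoPastur

/-! ### The theorem. -/

theorem proposition3p1 :
    ∃ c : ℝ, 0 < c ∧
      ∀ (n p : ℕ), 1 ≤ p → p ≤ n →
      ∀ (Ω : Type*) [MeasurableSpace Ω] (P : Measure Ω) [IsProbabilityMeasure P]
        (β : ℝ) (M : Ω → Matrix (Fin p) (Fin n) ℂ),
        0 < β →
        (∀ i j, Measurable (fun ω => M ω i j)) →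
        iIndepFun (fun (ij : Fin p × Fin n) ω => M ω ij.1 ij.2) P →
        (∀ i j, ∫ ω, M ω i j ∂P = 0) →
        (∀ i j, ∫ ω, ‖M ω i j‖ ^ 2 ∂P = 1) →
        (∀ i j, Integrable (fun ω => ‖M ω i j‖ ^ 4) P ∧ ∫ ω, ‖M ω i j‖ ^ 4 ∂P ≤ β) →
      ∀ (φ : ℝ), φ = (p : ℝ) / (n : ℝ) →
      ∀ z ∈ Set.Icc (MarchenkoPastur.lower φ) (MarchenkoPastur.upper φ),
        Integrable (fun ω => ‖((z : ℂ) • (1 : Matrix (Fin n) (Fin n) ℂ) -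
          (n : ℂ)⁻¹ • MarchenkoPastur.covMatrix (M ω)).det‖ ^ 2) P ∧
        ∫ ω, ‖((z : ℂ) • (1 : Matrix (Fin n) (Fin n) ℂ) -
          (n : ℂ)⁻¹ • MarchenkoPastur.covMatrix (M ω)).det‖ ^ 2 ∂P ≤
        c * (p : ℝ) ^ (13 / 2 : ℝ) * (n : ℝ) ^ (1 / 2 : ℝ) * Real.exp β *
          Real.exp (2 * n * MarchenkoPastur.logPotential (MarchenkoPastur.law φ) (z : ℂ)) := by
  refine ⟨12 * Real.exp 1 ^ 2, by positivity, ?_⟩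
  rintro n p hp hpn Ω _ P _ β M - hmeas hindep hmean hvar hfourth φ rfl z hz
  have hn : 1 ≤ n := hp.trans hpn
  have h : MarchenkoPastur.StandardEntries P (fun ω i j => M ω i j) β :=
    ⟨hmeas, hindep, hmean, hvar, fun i j => (hfourth i j).1, fun i j => (hfourth i j).2⟩
  have hβ : 1 ≤ β := h.one_le ⟨0, hp⟩ ⟨0, hn⟩
  have hcard : Fintype.card (Fin p) ≤ Fintype.card (Fin n) := by simpa using hpn
  have hz0 : 0 ≤ z := (sq_nonneg _).trans hz.1
  have hp1 : (1 : ℝ) ≤ p := by exact_mod_cast hp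
  have hx : 0 ≤ (n : ℝ) * z := by positivity
  have hdet : ∀ ω, ‖((z : ℂ) • (1 : Matrix (Fin n) (Fin n) ℂ) -
      (n : ℂ)⁻¹ • MarchenkoPastur.covMatrix (M ω)).det‖ ^ 2 =
      (n : ℝ)⁻¹ ^ (2 * n) * ((n * z) ^ (n - p)) ^ 2 *
        ‖(Matrix.scalar (Fin p) (((n * z : ℝ) : ℂ)) - M ω * (M ω)ᴴ).det‖ ^ 2 := by
    intro ω
    rw [MarchenkoPastur.det_smul_one_sub_covMatrix hpn hn, norm_mul, norm_mul, norm_pow, norm_pow,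
      norm_inv, norm_mul, Complex.norm_natCast, Complex.norm_real, Real.norm_of_nonneg hz0]
    push_cast
    ring
  have hInt := h.integrable_norm_det_sq hcard ((n * z : ℝ) : ℂ)
  have hle := h.integral_norm_det_sq_le hβ hcard ((n * z : ℝ) : ℂ)
  simp only [Fintype.card_fin] at hle
  simp_rw [hdet]
  refine ⟨hInt.const_mul _, ?_⟩
  rw [integral_const_mul]
  have hsum := MarchenkoPastur.sum_norm_laguerre_sq_mul_le hp hpn hx
  have hfin := MarchenkoPastur.factorial_bound_le_exp_logPotential hp hpn hz
  -- The estimates produce only `p³`, which is weakened to the stated power.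
  have hpow : (p : ℝ) ^ 3 ≤ (p : ℝ) ^ (13 / 2 : ℝ) := by
    rw [← Real.rpow_natCast]
    exact Real.rpow_le_rpow_of_exponent_le hp1 (by norm_num)
  have hexp : Real.exp (β - 1) ≤ Real.exp β := Real.exp_le_exp.mpr (by linarith)
  calc _ ≤ (n : ℝ)⁻¹ ^ (2 * n) * ((n * z) ^ (n - p)) ^ 2 *
        ∑ S : Finset (Fin p), ‖MarchenkoPastur.laguerre (p - S.card) (n - S.card)
          ((n * z : ℝ) : ℂ)‖ ^ 2 *
          (n.descFactorial S.card * ((Nat.factorial (S.card + 1)) * Real.exp (β - 1))) :=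
        mul_le_mul_of_nonneg_left hle (by positivity)
    -- Of the two factors `(nz)^(n-p)`, one is absorbed by the Laguerre bound and the other supplies
    -- the `z^(n-p)` in `e^(2nu)`.
    _ = (n : ℝ)⁻¹ ^ (2 * n) * (n * z) ^ (n - p) * ((n * z) ^ (n - p) *
        ∑ S : Finset (Fin p), ‖MarchenkoPastur.laguerre (p - S.card) (n - S.card)
          ((n * z : ℝ) : ℂ)‖ ^ 2 *
          (n.descFactorial S.card * (Nat.factorial (S.card + 1)))) * Real.exp (β - 1) := by
        simp_rw [← mul_assoc, ← Finset.sum_mul]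
        ring
    _ ≤ (n : ℝ)⁻¹ ^ (2 * n) * (n * z) ^ (n - p) * (12 * p ^ 2 * √p *
          (Nat.factorial p * Nat.factorial n * Real.exp (n * z))) * Real.exp (β - 1) := by
        gcongr
    _ ≤ 12 * Real.exp 1 ^ 2 * p ^ 3 * √n * Real.exp (2 * n *
          MarchenkoPastur.logPotential (MarchenkoPastur.law (p / n)) z) * Real.exp (β - 1) := by
        gcongr
    _ ≤ 12 * Real.exp 1 ^ 2 * (p : ℝ) ^ (13 / 2 : ℝ) * √n * Real.exp (2 * n *
          MarchenkoPastur.logPotential (MarchenkoPastur.law (p / n)) z) * Real.exp β := by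
        gcongr
    _ = _ := by
        rw [Real.sqrt_eq_rpow]
        ring
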